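/- Let $N\ge 2$, $n:=2^{N-1}$, and let $\lambda_1\ge\lambda_2\ge\dots\ge\lambda_{2n}\ge 0$ with $\sum_k\lambda_k=1$; put $\Lambda=\mathrm{diag}[\lambda_1,\dots,\lambda_{2n}]$. Operators on $(\mathbb C^2)^{\otimes N}$ are written as $2n\times 2n$ matrices in the computational basis, and "spectrum" means the eigenvalues counted with multiplicity. Definitions. The GM-concurrence of a pure $N$-qubit state is $C_{\rm GM}(|\psi\rangle)=\min_{A}\sqrt2\sqrt{1-\mathrm{tr}[\rho_A^2]}$, the minimum being over all bipartitions $A|B$ of the $N$ qubits into two non-empty parts, with $\rho_A=\mathrm{tr}_B|\psi\rangle\langle\psi|$. For a density matrix, $C_{\rm GM}(\rho)=\inf\sum_i p_i\,C_{\rm GM}(|\psi_i\rangle)$ over all finite ensembles with $\rho=\sum_i p_i|\psi_i\rangle\langle\psi_i|$, where $p_i\ge 0$, $\sum_i p_i=1$ and the $|\psi_i\rangle$ are unit vectors. An X-density matrix is a $2n\times 2n$ matrix with diagonal $(a_1,\dots,a_n,b_n,\dots,b_1)$, antidiagonal (from the top row down) $(r_1e^{i\phi_1},\dots,r_ne^{i\phi_n},r_ne^{-i\phi_n},\dots,r_1e^{-i\phi_1})$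 and all other entries zero, where $a_k,b_k\ge 0$, $\phi_k\in[0,2\pi]$, $0\le r_k\le\sqrt{a_kb_k}$ and $\sum_k(a_k+b_k)=1$. An $N$-qubit X-state is a matrix $W\sigma W^\dagger$ with $\sigma$ an X-density matrix and $W$ a tensor product of $N$ single-qubit unitaries. Theorem. (i) The maximal GM-concurrence attained by an $N$-qubit X-state of spectrum $(\lambda_k)$ is $$C^*=\max\Big[0,\ \lambda_1-\lambda_{n+1}-2\sum_{\ell=2}^{n}\sqrt{\lambda_\ell\,\lambda_{2n+2-\ell}}\Big].$$ (ii) It is attained by the X-density matrix $\rho'_\Lambda$ with $a_1=b_1=\frac{\lambda_1+\lambda_{n+1}}2$, $r_1=\frac{\lambda_1-\lambda_{n+1}}2$, all $\phi_k=0$ and, for $2\le j\le n$, $a_j=\lambda_j$, $b_j=\lambda_{2n+2-j}$, $r_j=0$; this matrix has spectrum $(\lambda_k)$. (iii) Let $\rho_\Lambda$ be any $N$-qubit density matrix of spectrum $(\lambda_k)$. There is a unitary $\Phi$ with $\rho_\Lambda=\Phi\Lambda\Phi^\dagger$. For every such $\Phi$, all single-qubit unitaries $U_1,\dots,U_N$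 and every diagonal unitary $D_\phi$, the matrix $$\mathcal U=\Big(\bigotimes_{k=1}^N U_k\Big)\begin{bmatrix}V_{11}&V_{12}\\V_{21}&V_{22}\end{bmatrix}D_\phi\,\Phi^\dagger$$ is unitary and $$\mathcal U\rho_\Lambda\,\mathcal U^\dagger=\Big(\bigotimes_k U_k\Big)\rho'_\Lambda\Big(\bigotimes_k U_k\Big)^\dagger,$$ which is an X-state of spectrum $(\lambda_k)$ with GM-concurrence $C^*$. Here, with $E_{i,j}$ the $n\times n$ matrix units, $$V_{12}=\tfrac1{\sqrt2}E_{1,1},\quad V_{11}=V_{12}+\sum_{i=2}^nE_{i,i},\quad V_{21}=\tfrac1{\sqrt2}E_{n,1},\quad V_{22}=-V_{21}+\sum_{i=1}^{n-1}E_{i,i+1}.$$ -/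

import Mathlib

noncomputable section

namespace XMEMS

open scoped ComplexOrder

/-- Operators on `N` qubits, as matrices in the computational basis `|bin i⟩`, `0 ≤ i < 2^N`. -/
abbrev QMat (N : ℕ) : Type := Matrix (Fin (2 ^ N)) (Fin (2 ^ N)) ℂ

/-- The binary digits of `i`; qubit `0` carries the most significant digit, so that `|bin i⟩` is
the tensor product, from left to right, of the basis vectors `|bits i k⟩`, `k = 0, …, N - 1`. -/
def bits (N : ℕ) : Fin (2 ^ N) ≃ (Fin N → Fin 2) :=
  finFunctionFinEquiv.symm.trans (Equiv.arrowCongr Fin.revPerm (Equiv.refl (Fin 2)))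

/-- The local operator `U₁ ⊗ ⋯ ⊗ U_N`. -/
def localOp {N : ℕ} (U : Fin N → Matrix (Fin 2) (Fin 2) ℂ) : QMat N :=
  Matrix.of fun i j => ∏ k, U k (bits N i k) (bits N j k)

/-- Density matrices. -/
def IsDensity {N : ℕ} (ρ : QMat N) : Prop := ρ.PosSemidef ∧ ρ.trace = 1

/-- The eigenvalues of `ρ`, counted with multiplicity, are `lam 1, …, lam (2^N)`. -/
def HasSpectrum {N : ℕ} (ρ : QMat N) (lam : ℕ → ℝ) : Prop :=
  ρ.charpoly.roots = (Finset.Icc 1 (2 ^ N)).val.map fun k => (lam k : ℂ)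

/-! ### GM-concurrence -/

/-- Basis index of the joint configuration with digits `s` on `A` and `t` off `A`. -/
def glue {N : ℕ} (A : Finset (Fin N)) (s : {k // k ∈ A} → Fin 2) (t : {k // k ∉ A} → Fin 2) :
    Fin (2 ^ N) :=
  (bits N).symm ((Equiv.piEquivPiSubtypeProd (fun k => k ∈ A) fun _ => Fin 2).symm (s, t))

/-- Partial trace over the qubits outside `A`. -/
def reduced {N : ℕ} (A : Finset (Fin N)) (ρ : QMat N) :
    Matrix ({k // k ∈ A} → Fin 2) ({k // k ∈ A} → Fin 2) ℂ :=
  Matrix.of fun s s' => ∑ t, ρ (glue A s t) (glue A s' t)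

/-- The operator `|ψ⟩⟨ψ|`. -/
def ketbra {N : ℕ} (ψ : Fin (2 ^ N) → ℂ) : QMat N := Matrix.vecMulVec ψ (star ψ)

/-- The bipartitions `A | Aᶜ` of the qubits into two nonempty parts, given by one part `A`.
(Each occurs twice, as `A` and as `Aᶜ`; this does not affect the minimum below, since the two
reductions of a pure state have the same purity.) -/
def Bipartition (N : ℕ) : Type := {A : Finset (Fin N) // A.Nonempty ∧ Aᶜ.Nonempty}

/-- GM-concurrence of a pure state. For `2 ≤ N` the infimum is over a nonempty finite set, hence a
minimum. -/
def pureCGM {N : ℕ} (ψ : Fin (2 ^ N) → ℂ) : ℝ :=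
  ⨅ A : Bipartition N, √2 * √(1 - (reduced A.1 (ketbra ψ) ^ 2).trace.re)

/-- The pure states `ψ i` with probabilities `p i` form an ensemble realizing `ρ`. -/
def IsEnsemble {N m : ℕ} (ρ : QMat N) (p : Fin m → ℝ) (ψ : Fin m → Fin (2 ^ N) → ℂ) : Prop :=
  (∀ i, 0 ≤ p i) ∧ ∑ i, p i = 1 ∧ (∀ i, ∑ j, ‖ψ i j‖ ^ 2 = 1) ∧
    ρ = ∑ i, (p i : ℂ) • ketbra (ψ i)

/-- GM-concurrence of a density matrix: the convex roof of the pure-state quantity. -/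
def CGM {N : ℕ} (ρ : QMat N) : ℝ :=
  sInf {c | ∃ (m : ℕ) (p : Fin m → ℝ) (ψ : Fin m → Fin (2 ^ N) → ℂ),
    IsEnsemble ρ p ψ ∧ c = ∑ i, p i * pureCGM (ψ i)}

/-! ### X-states -/

/-- Assemble a `2^N`-dimensional matrix from four blocks of dimension `n = 2^(N-1)`. -/
def ofBlocks {N : ℕ} (hN : 2 ≤ N)
    (M : Matrix (Fin (2 ^ (N - 1)) ⊕ Fin (2 ^ (N - 1))) (Fin (2 ^ (N - 1)) ⊕ Fin (2 ^ (N - 1))) ℂ) :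
    QMat N :=
  let e : Fin (2 ^ (N - 1)) ⊕ Fin (2 ^ (N - 1)) ≃ Fin (2 ^ N) :=
    finSumFinEquiv.trans (finCongr (by
      rw [← two_mul, ← pow_succ', Nat.sub_add_cancel (by omega)]))
  Matrix.reindex e e M

/-- The matrix with diagonal `a₁, …, a_n, b_n, …, b₁` and antidiagonal
`r₁ exp(iφ₁), …, r_n exp(iφ_n), r_n exp(-iφ_n), …, r₁ exp(-iφ₁)` (read from the top row down).
Only the values of `a, b, r, φ` at `1, …, n` matter. -/
def xMatrix {N : ℕ} (hN : 2 ≤ N) (a b r φ : ℕ → ℝ) : QMat N :=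
  ofBlocks hN (Matrix.fromBlocks
    (Matrix.diagonal fun k => (a ((k : ℕ) + 1) : ℂ))
    (Matrix.of fun k j =>
      if j = k.rev then (r ((k : ℕ) + 1) : ℂ) * Complex.exp (Complex.I * φ ((k : ℕ) + 1)) else 0)
    (Matrix.of fun i k =>
      if i = k.rev then (r ((k : ℕ) + 1) : ℂ) * Complex.exp (-(Complex.I * φ ((k : ℕ) + 1))) else 0)
    (Matrix.diagonal fun i => (b ((i.rev : ℕ) + 1) : ℂ)))

/-- `ρ` is an X-density matrix: a matrix of X-form with the normalization and positivity
constraints on its parameters. -/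
def IsXDensity {N : ℕ} (hN : 2 ≤ N) (ρ : QMat N) : Prop :=
  ∃ a b r φ : ℕ → ℝ,
    (∀ k ∈ Finset.Icc 1 (2 ^ (N - 1)),
      0 ≤ a k ∧ 0 ≤ b k ∧ 0 ≤ r k ∧ r k ≤ √(a k * b k) ∧ 0 ≤ φ k ∧ φ k ≤ 2 * Real.pi) ∧
    ∑ k ∈ Finset.Icc 1 (2 ^ (N - 1)), (a k + b k) = 1 ∧
    ρ = xMatrix hN a b r φ

/-- `ρ` is an `N`-qubit X-state: an X-density matrix up to a local unitary transformation. -/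
def IsXState {N : ℕ} (hN : 2 ≤ N) (ρ : QMat N) : Prop :=
  ∃ (U : Fin N → Matrix (Fin 2) (Fin 2) ℂ) (σ : QMat N),
    (∀ k, U k ∈ Matrix.unitaryGroup (Fin 2) ℂ) ∧ IsXDensity hN σ ∧
    ρ = localOp U * σ * (localOp U).conjTranspose

/-! ### The optimal value, the optimal state and the unitary -/

/-- `max [0, λ₁ - λ_{n+1} - 2 ∑_{ℓ=2}^n √(λ_ℓ λ_{2n+2-ℓ})]`, with `n = 2^(N-1)`. -/
def optCGM (N : ℕ) (lam : ℕ → ℝ) : ℝ :=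
  let n := 2 ^ (N - 1)
  max 0 (lam 1 - lam (n + 1) - 2 * ∑ l ∈ Finset.Icc 2 n, √(lam l * lam (2 * n + 2 - l)))

/-- The X-matrix `ρ'_Λ`: `a₁ = b₁ = (λ₁ + λ_{n+1})/2`, `r₁ = (λ₁ - λ_{n+1})/2` and, for
`2 ≤ j ≤ n`, `a_j = λ_j`, `b_j = λ_{2n+2-j}`, `r_j = 0`; all phases vanish. -/
def rhoOpt {N : ℕ} (hN : 2 ≤ N) (lam : ℕ → ℝ) : QMat N :=
  let n := 2 ^ (N - 1)
  xMatrix hN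
    (fun k => if k = 1 then (lam 1 + lam (n + 1)) / 2 else lam k)
    (fun k => if k = 1 then (lam 1 + lam (n + 1)) / 2 else lam (2 * n + 2 - k))
    (fun k => if k = 1 then (lam 1 - lam (n + 1)) / 2 else 0)
    (fun _ => 0)

/-- The matrix unit `E_{i,j}` of dimension `n`, rows and columns being counted from `1`. -/
def unitE (n i j : ℕ) : Matrix (Fin n) (Fin n) ℂ :=
  Matrix.of fun p q => if (p : ℕ) + 1 = i ∧ (q : ℕ) + 1 = j then 1 else 0

/-- The matrix `V`. -/
def V {N : ℕ} (hN : 2 ≤ N) : QMat N :=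
  let n := 2 ^ (N - 1)
  let V12 : Matrix (Fin n) (Fin n) ℂ := ((1 / √2 : ℝ) : ℂ) • unitE n 1 1
  let V11 : Matrix (Fin n) (Fin n) ℂ := V12 + ∑ i ∈ Finset.Icc 2 n, unitE n i i
  let V21 : Matrix (Fin n) (Fin n) ℂ := ((1 / √2 : ℝ) : ℂ) • unitE n n 1
  let V22 : Matrix (Fin n) (Fin n) ℂ := -V21 + ∑ i ∈ Finset.Icc 1 (n - 1), unitE n i (i + 1)
  ofBlocks hN (Matrix.fromBlocks V11 V12 V21 V22)

/-- `Λ = diag[λ₁, …, λ_{2n}]`. -/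
def Lam (N : ℕ) (lam : ℕ → ℝ) : QMat N := Matrix.diagonal fun i => (lam ((i : ℕ) + 1) : ℂ)

/-- `Φ` is a unitary matrix of eigenvectors of `ρ`, with `ρ = Φ Λ Φ†`. -/
def Diagonalizes {N : ℕ} (Φ ρ : QMat N) (lam : ℕ → ℝ) : Prop :=
  Φ ∈ Matrix.unitaryGroup (Fin (2 ^ N)) ℂ ∧ ρ = Φ * Lam N lam * Φ.conjTranspose

/-- The global unitary `(⊗ U_k) V D Φ†`. -/
def globalU {N : ℕ} (hN : 2 ≤ N) (U : Fin N → Matrix (Fin 2) (Fin 2) ℂ) (D Φ : QMat N) : QMat N :=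
  localOp U * V hN * D * Φ.conjTranspose

end XMEMS

end

noncomputable section

namespace XMEMS

open scoped ComplexOrder

/-! ### Computational basis: complementary bit strings -/

/-! The indices `i` and `i.rev` are complementary bit strings, so an X-matrix is a direct sum of
blocks $\begin{pmatrix}a_k&z_k\\ \bar z_k&b_k\end{pmatrix}$, $|z_k|=r_k$, one for each complementary
pair. Everything reduces to an estimate of $C_{\rm GM}$ in terms of these blocks and an optimization
over the ways of distributing the spectrum among them.

Upper bound (`decomposes_xMatrix`). A normalized block with diagonal $s,1/s$ and unimodular
off-diagonal entry is a rank-one projector up to scale, and costs 2. The sum of two such blocks on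
different pairs costs nothing: it is an equal mixture of $v+w$ and $v-w$, and with a suitable phase
of $w$ both are product vectors across the bipartition separating the digits where the two strings
agree from those where they differ. If block $k$ carries a weight $c_k$ with $|z_k|\le
c_k\le\sqrt{a_kb_k}$, the remainder is diagonal and free. Weights satisfying the polygon
inequalities are nonnegative combinations of the vectors $e_i+e_j$ (`polygon_induction`), so only an
excess of one weight over the sum of the others costs anything. Hence $C_{\rm GM}$ is at most $0$
or, for some $i$, at most $2(|z_i|-\sum_{k\ne i}\sqrt{a_kb_k})$.

Spectrum (`pair_excess_le`). If block $k$ has eigenvalues $\mu_k\ge\nu_k$, then $2r_i\le\mu_i-\nu_i$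
and $a_kb_k\ge\mu_k\nu_k$, so the bound is at most $\mu_i-\nu_i-2\sum_{k\ne i}\sqrt{\mu_k\nu_k}$.
The pairing of eigenvalues is a permutation of the spectrum, and the rearrangement inequality for
the $\sqrt{\lambda_j}$ gives the optimum.

Lower bound (`le_CGM`). For every bipartition, a $2\times2$ minor of the amplitude matrix compares
the product of the all-zero and all-one amplitudes with the product for one other complementary
pair. Averaging over an ensemble bounds $C_{\rm GM}$ below, and for $\rho'_\Lambda$ this meets the
upper bound. Invariance under local unitaries and $V\Lambda V^\dagger=\rho'_\Lambda$ give the rest.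
-/

theorem bits_rev (N : ℕ) (i : Fin (2 ^ N)) (k : Fin N) :
    bits N i.rev k = (bits N i k).rev := by
  have key : ∀ f : Fin N → Fin 2,
      finFunctionFinEquiv (fun k => (f k).rev) = (finFunctionFinEquiv f).rev := by
    intro f
    apply Fin.ext
    -- A digit and its complement add up to 1, so the two numbers add up to $\sum_k 2^k=2^N-1$.
    have h : ((finFunctionFinEquiv fun k => (f k).rev : Fin (2 ^ N)) : ℕ) +
        (finFunctionFinEquiv f : ℕ) = 2 ^ N - 1 := by
      rw [finFunctionFinEquiv_apply, finFunctionFinEquiv_apply, ← Finset.sum_add_distrib]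
      have h2 : ∀ k : Fin N, ((f k).rev : ℕ) * 2 ^ (k : ℕ) + (f k : ℕ) * 2 ^ (k : ℕ)
          = 2 ^ (k : ℕ) := by
        intro k
        have : ((f k).rev : ℕ) + (f k : ℕ) = 1 := by
          rw [Fin.val_rev]; omega
        rw [← add_mul, this, one_mul]
      rw [Finset.sum_congr rfl fun k _ => h2 k, Fin.sum_univ_eq_sum_range (fun k => 2 ^ k) N,
        Nat.geomSum_eq (le_refl 2)]
      simp
    rw [Fin.val_rev]
    omega
  have h := key (finFunctionFinEquiv.symm i)
  rw [Equiv.apply_symm_apply] at h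
  have h' := congrArg finFunctionFinEquiv.symm h
  rw [Equiv.symm_apply_apply] at h'
  change finFunctionFinEquiv.symm i.rev k.rev = (finFunctionFinEquiv.symm i k.rev).rev
  rw [← h']

theorem bits_zero (N : ℕ) (k : Fin N) : bits N ⟨0, by positivity⟩ k = 0 := by
  change finFunctionFinEquiv.symm _ k.rev = 0
  apply Fin.ext
  change 0 / 2 ^ _ % 2 = 0
  simp

/-! ### Block coordinates -/

/-- The splitting of the basis into two halves. -/
def halfEquiv {N : ℕ} (hN : 2 ≤ N) : Fin (2 ^ (N - 1)) ⊕ Fin (2 ^ (N - 1)) ≃ Fin (2 ^ N) :=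
  finSumFinEquiv.trans (finCongr (by
    rw [← two_mul, ← pow_succ', Nat.sub_add_cancel (by omega)]))

/-- The basis as a union of pairs of complementary bit strings. -/
def pairEquiv {N : ℕ} (hN : 2 ≤ N) : Fin (2 ^ (N - 1)) ⊕ Fin (2 ^ (N - 1)) ≃ Fin (2 ^ N) :=
  (Equiv.sumCongr (Equiv.refl _) Fin.revPerm).trans (halfEquiv hN)

/-- Half the basis, indexing the pairs of complementary bit strings. -/
def low {N : ℕ} (hN : 2 ≤ N) (k : Fin (2 ^ (N - 1))) : Fin (2 ^ N) := pairEquiv hN (Sum.inl k)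

theorem two_mul_half {N : ℕ} (hN : 2 ≤ N) : 2 * 2 ^ (N - 1) = 2 ^ N := by
  rw [← pow_succ', Nat.sub_add_cancel (by omega)]

theorem low_val {N : ℕ} (hN : 2 ≤ N) (k : Fin (2 ^ (N - 1))) : (low hN k : ℕ) = k := rfl

theorem pairEquiv_inl {N : ℕ} (hN : 2 ≤ N) (k : Fin (2 ^ (N - 1))) :
    pairEquiv hN (Sum.inl k) = low hN k := rfl

theorem pairEquiv_inr {N : ℕ} (hN : 2 ≤ N) (k : Fin (2 ^ (N - 1))) :
    pairEquiv hN (Sum.inr k) = (low hN k).rev := by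
  apply Fin.ext
  have h := two_mul_half hN
  have : ((pairEquiv hN (Sum.inr k) : Fin (2 ^ N)) : ℕ) = 2 ^ (N - 1) + (k.rev : ℕ) := rfl
  rw [this, Fin.val_rev, Fin.val_rev, low_val]
  omega

theorem low_injective {N : ℕ} (hN : 2 ≤ N) : Function.Injective (low hN) :=
  (pairEquiv hN).injective.comp Sum.inl_injective

theorem low_ne_rev_low {N : ℕ} (hN : 2 ≤ N) (j k : Fin (2 ^ (N - 1))) :
    low hN j ≠ (low hN k).rev := by
  rw [← pairEquiv_inl, ← pairEquiv_inr]
  exact fun h => Sum.inl_ne_inr ((pairEquiv hN).injective h)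

theorem exists_low {N : ℕ} (hN : 2 ≤ N) (i : Fin (2 ^ N)) :
    ∃ k, i = low hN k ∨ i = (low hN k).rev := by
  obtain ⟨x, rfl⟩ := (pairEquiv hN).surjective i
  rcases x with k | k
  · exact ⟨k, Or.inl rfl⟩
  · exact ⟨k, Or.inr (pairEquiv_inr hN k)⟩

/-- The antidiagonal entry `r exp(iφ)` of an X-matrix. -/
def antiEntry (r φ : ℕ → ℝ) (k : ℕ) : ℂ := (r k : ℂ) * Complex.exp (Complex.I * φ k)

theorem star_antiEntry (r φ : ℕ → ℝ) (k : ℕ) :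
    star (antiEntry r φ k) = (r k : ℂ) * Complex.exp (-(Complex.I * φ k)) := by
  simp only [antiEntry, Complex.star_def, map_mul, Complex.conj_ofReal, ← Complex.exp_conj,
    Complex.conj_I, neg_mul]

theorem norm_antiEntry (r φ : ℕ → ℝ) (k : ℕ) (h : 0 ≤ r k) : ‖antiEntry r φ k‖ = r k := by
  rw [antiEntry, norm_mul, mul_comm Complex.I, Complex.norm_exp_ofReal_mul_I, mul_one,
    Complex.norm_real, Real.norm_of_nonneg h]

/-- In the basis of complementary pairs the four blocks of an X-matrix are diagonal. -/
theorem xMatrix_eq_reindex {N : ℕ} (hN : 2 ≤ N) (a b r φ : ℕ → ℝ) :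
    xMatrix hN a b r φ = Matrix.reindex (pairEquiv hN) (pairEquiv hN) (Matrix.fromBlocks
      (Matrix.diagonal fun k : Fin (2 ^ (N - 1)) => (a ((k : ℕ) + 1) : ℂ))
      (Matrix.diagonal fun k : Fin (2 ^ (N - 1)) => antiEntry r φ ((k : ℕ) + 1))
      (Matrix.diagonal fun k : Fin (2 ^ (N - 1)) => star (antiEntry r φ ((k : ℕ) + 1)))
      (Matrix.diagonal fun k : Fin (2 ^ (N - 1)) => (b ((k : ℕ) + 1) : ℂ))) := by
  ext i j
  obtain ⟨x, rfl⟩ := (halfEquiv hN).surjective i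
  obtain ⟨y, rfl⟩ := (halfEquiv hN).surjective j
  have hE : ∀ x, (pairEquiv hN).symm (halfEquiv hN x) = Sum.map id Fin.rev x := by
    intro x
    rw [Equiv.symm_apply_eq]
    rcases x with x | x <;> simp [pairEquiv]
  change ((Matrix.reindex (halfEquiv hN) (halfEquiv hN)) _) _ _ = _
  simp only [Matrix.reindex_apply, Matrix.submatrix_apply, Equiv.symm_apply_apply, hE]
  rcases x with x | x <;> rcases y with y | y
  · simp
  · simp only [Sum.map_inl, Sum.map_inr, Matrix.fromBlocks_apply₁₂, Matrix.of_apply,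
      Matrix.diagonal_apply, antiEntry, id]
    refine if_congr ?_ rfl rfl
    constructor
    · rintro rfl; simp
    · rintro rfl; simp
  · simp only [Sum.map_inl, Sum.map_inr, Matrix.fromBlocks_apply₂₁, Matrix.of_apply,
      Matrix.diagonal_apply, star_antiEntry, id]
    by_cases h : x = y.rev
    · subst h; simp
    · rw [if_neg h, if_neg]
      rintro rfl; simp at h
  · simp [Matrix.diagonal_apply]

theorem sum_Icc_one_eq_sum_fin {M : Type*} [AddCommMonoid M] (m : ℕ) (f : ℕ → M) :
    ∑ k ∈ Finset.Icc 1 m, f k = ∑ i : Fin m, f ((i : ℕ) + 1) := by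
  rw [Fin.sum_univ_eq_sum_range (fun i => f (i + 1)) m, Finset.range_eq_Ico,
    Finset.sum_Ico_add' f 0 m 1]
  rfl

/-! ### Spectra -/

theorem hasSpectrum_iff {N : ℕ} (ρ : QMat N) (lam : ℕ → ℝ) :
    HasSpectrum ρ lam ↔
      ρ.charpoly.roots = Finset.univ.val.map fun i : Fin (2 ^ N) => (lam ((i : ℕ) + 1) : ℂ) := by
  have h : ((Finset.Icc 1 (2 ^ N)).val.map fun k => (lam k : ℂ)) =
      Finset.univ.val.map fun i : Fin (2 ^ N) => (lam ((i : ℕ) + 1) : ℂ) := by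
    have := sum_Icc_one_eq_sum_fin (2 ^ N) (fun k => ({(lam k : ℂ)} : Multiset ℂ))
    have g : ∀ {ι : Type} (s : Finset ι) (f : ι → ℂ),
        (∑ k ∈ s, ({f k} : Multiset ℂ)) = s.val.map f := by
      intro ι s f
      have h := Multiset.map_map (fun a => ({a} : Multiset ℂ)) f s.val
      rw [← Multiset.sum_map_singleton (s.val.map f), h]
      rfl
    rwa [g, g] at this
  rw [HasSpectrum, h]

theorem charpoly_conj_unitary {ι : Type*} [Fintype ι] [DecidableEq ι] {U : Matrix ι ι ℂ}
    (hU : U ∈ Matrix.unitaryGroup ι ℂ) (ρ : Matrix ι ι ℂ) :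
    (U * ρ * U.conjTranspose).charpoly = ρ.charpoly := by
  rw [Matrix.charpoly_mul_comm, ← mul_assoc]
  have : U.conjTranspose * U = 1 := Matrix.mem_unitaryGroup_iff'.1 hU
  rw [this, one_mul]

theorem hasSpectrum_conj_unitary {N : ℕ} {U : QMat N}
    (hU : U ∈ Matrix.unitaryGroup (Fin (2 ^ N)) ℂ) (ρ : QMat N) (lam : ℕ → ℝ) :
    HasSpectrum (U * ρ * U.conjTranspose) lam ↔ HasSpectrum ρ lam := by
  rw [HasSpectrum, HasSpectrum, charpoly_conj_unitary hU]

theorem roots_charpoly_diagonal {ι : Type*} [Fintype ι] [DecidableEq ι] (d : ι → ℂ) :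
    (Matrix.diagonal d).charpoly.roots = Finset.univ.val.map d := by
  rw [Matrix.charpoly_diagonal, Polynomial.roots_prod]
  · simp [Polynomial.roots_X_sub_C, Multiset.bind_singleton]
  · exact Finset.prod_ne_zero_iff.2 fun i _ => Polynomial.X_sub_C_ne_zero _

theorem hasSpectrum_Lam (N : ℕ) (lam : ℕ → ℝ) : HasSpectrum (Lam N lam) lam := by
  rw [hasSpectrum_iff, Lam, roots_charpoly_diagonal]

open Polynomial in
theorem charpoly_fromBlocks_diagonal {ι : Type*} [Fintype ι] [DecidableEq ι] (a b c d : ι → ℂ) :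
    (Matrix.fromBlocks (Matrix.diagonal a) (Matrix.diagonal b) (Matrix.diagonal c)
      (Matrix.diagonal d)).charpoly = ∏ k, ((X - C (a k)) * (X - C (d k)) - C (b k * c k)) := by
  let e : ι ⊕ ι ≃ Fin 2 × ι :=
    (Equiv.boolProdEquivSum ι).symm.trans (Equiv.prodCongr finTwoEquiv.symm (Equiv.refl ι))
  have h : Matrix.charmatrix (Matrix.fromBlocks (Matrix.diagonal a) (Matrix.diagonal b)
      (Matrix.diagonal c) (Matrix.diagonal d)) = (Matrix.blockDiagonal fun k =>
        !![X - C (a k), -C (b k); -C (c k), X - C (d k)]).submatrix e e := by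
    have h0 : finTwoEquiv.symm false = 0 := rfl
    have h1 : finTwoEquiv.symm true = 1 := rfl
    ext1 x y
    rcases x with x | x <;> rcases y with y | y <;> by_cases hxy : x = y <;>
      simp [e, hxy, Matrix.blockDiagonal_apply, h0, h1]
  rw [Matrix.charpoly, h, Matrix.det_submatrix_equiv_self, Matrix.det_blockDiagonal]
  refine Finset.prod_congr rfl fun k _ => ?_
  rw [Matrix.det_fin_two_of, C_mul]
  ring

/-- Two families with the same multiset of values differ by a bijection of the index types. -/
theorem exists_equiv_of_map_univ_eq {α β γ : Type*} [Fintype α] [Fintype β] (f : α → γ)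
    (g : β → γ) (h : Finset.univ.val.map f = Finset.univ.val.map g) :
    ∃ σ : α ≃ β, ∀ a, g (σ a) = f a := by
  classical
  have key : ∀ c, Nonempty ({a // f a = c} ≃ {b // g b = c}) := by
    intro c
    rw [← Fintype.card_eq, Fintype.card_subtype, Fintype.card_subtype]
    have := congrArg (Multiset.count c) h
    rw [Multiset.count_map, Multiset.count_map] at this
    simpa [Finset.card, Finset.filter_val, eq_comm] using this
  let e : ∀ c, {a // f a = c} ≃ {b // g b = c} := fun c => (key c).some
  exact ⟨Equiv.ofFiberEquiv e, fun a => Equiv.ofFiberEquiv_map e a⟩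

/-- The larger (`s = 1`) and the smaller (`s = -1`) eigenvalue of `[[a, z], [z̄, b]]`, `|z| = r`. -/
def blockEig (s a b r : ℝ) : ℝ := (a + b + s * √((a - b) ^ 2 + 4 * r ^ 2)) / 2

theorem blockEig_add (a b r : ℝ) : blockEig 1 a b r + blockEig (-1) a b r = a + b := by
  unfold blockEig; ring

theorem blockEig_sub (a b r : ℝ) :
    blockEig 1 a b r - blockEig (-1) a b r = √((a - b) ^ 2 + 4 * r ^ 2) := by
  unfold blockEig; ring

theorem blockEig_mul (a b r : ℝ) : blockEig 1 a b r * blockEig (-1) a b r = a * b - r ^ 2 := by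
  have h : √((a - b) ^ 2 + 4 * r ^ 2) ^ 2 = (a - b) ^ 2 + 4 * r ^ 2 := Real.sq_sqrt (by positivity)
  unfold blockEig
  linear_combination (-1 / 4) * h

theorem two_mul_le_blockEig_sub (a b r : ℝ) :
    2 * r ≤ blockEig 1 a b r - blockEig (-1) a b r := by
  rw [blockEig_sub]
  apply Real.le_sqrt_of_sq_le
  nlinarith [sq_nonneg (a - b)]

open Polynomial in
theorem roots_charpoly_xMatrix {N : ℕ} (hN : 2 ≤ N) (a b r φ : ℕ → ℝ)
    (hr : ∀ k ∈ Finset.Icc 1 (2 ^ (N - 1)), 0 ≤ r k) :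
    (xMatrix hN a b r φ).charpoly.roots =
      Finset.univ.val.map fun x : Fin (2 ^ (N - 1)) ⊕ Fin (2 ^ (N - 1)) =>
        ((Sum.elim (fun k : Fin (2 ^ (N - 1)) => blockEig 1 (a (k + 1)) (b (k + 1)) (r (k + 1)))
          (fun k : Fin (2 ^ (N - 1)) => blockEig (-1) (a (k + 1)) (b (k + 1)) (r (k + 1))) x
          : ℝ) : ℂ) := by
  rw [← roots_charpoly_diagonal, xMatrix_eq_reindex, Matrix.charpoly_reindex,
    charpoly_fromBlocks_diagonal, Matrix.charpoly_diagonal, Fintype.prod_sum_type,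
    ← Finset.prod_mul_distrib]
  congr 1
  refine Finset.prod_congr rfl fun k _ => ?_
  have hz : antiEntry r φ (k + 1) * star (antiEntry r φ (k + 1)) = ((r (k + 1)) ^ 2 : ℝ) := by
    rw [Complex.star_def, Complex.mul_conj, Complex.normSq_eq_norm_sq, norm_antiEntry]
    exact hr _ (by simp [Finset.mem_Icc])
  simp only [Sum.elim_inl, Sum.elim_inr]
  rw [hz]
  have h1 := congrArg (fun t : ℝ => (C (t : ℂ))) (blockEig_add (a (k + 1)) (b (k + 1)) (r (k + 1)))
  have h2 := congrArg (fun t : ℝ => (C (t : ℂ))) (blockEig_mul (a (k + 1)) (b (k + 1)) (r (k + 1)))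
  simp only [Complex.ofReal_add, Complex.ofReal_mul, Complex.ofReal_sub, C_add, C_mul, C_sub]
    at h1 h2
  linear_combination X * h1 - h2

/-! ### The matrix `V` and the state `ρ'_Λ` -/

/-- The columns of `V`, in the order in which `V` becomes block diagonal. -/
def colEquiv {N : ℕ} (hN : 2 ≤ N) : Fin (2 ^ (N - 1)) ⊕ Fin (2 ^ (N - 1)) ≃ Fin (2 ^ N) :=
  (Equiv.sumCongr (Equiv.refl _) (Equiv.neg _)).trans (halfEquiv hN)

theorem colEquiv_inl_val {N : ℕ} (hN : 2 ≤ N) (k : Fin (2 ^ (N - 1))) :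
    (colEquiv hN (Sum.inl k) : ℕ) = k := rfl

theorem colEquiv_inr_val {N : ℕ} (hN : 2 ≤ N) (k : Fin (2 ^ (N - 1))) :
    (colEquiv hN (Sum.inr k) : ℕ) = 2 ^ (N - 1) + (-k : Fin (2 ^ (N - 1))) := rfl

theorem val_neg_of_ne_zero {n : ℕ} [NeZero n] {k : Fin n} (hk : k ≠ 0) :
    ((-k : Fin n) : ℕ) = n - k := by
  rw [Fin.val_neg, if_neg hk]

theorem unitE_apply (n i j : ℕ) (p q : Fin n) :
    unitE n i j p q = if (p : ℕ) + 1 = i ∧ (q : ℕ) + 1 = j then 1 else 0 := rfl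

theorem sum_unitE_diag (n : ℕ) (p q : Fin n) :
    (∑ i ∈ Finset.Icc 2 n, unitE n i i) p q = if p = q ∧ (p : ℕ) ≠ 0 then 1 else 0 := by
  rw [Matrix.sum_apply]
  simp only [unitE_apply]
  split_ifs with h
  · rw [Finset.sum_eq_single ((p : ℕ) + 1)]
    · simp [h.1]
    · intro b _ hb
      rw [if_neg]
      rintro ⟨h1, _⟩
      exact hb h1.symm
    · intro hp
      exact absurd (Finset.mem_Icc.2 ⟨by omega, by omega⟩) hp
  · refine Finset.sum_eq_zero fun i hi => if_neg ?_
    rintro ⟨h1, h2⟩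
    rw [Finset.mem_Icc] at hi
    exact h ⟨Fin.ext (by omega), by omega⟩

theorem sum_unitE_shift (n : ℕ) (p q : Fin n) :
    (∑ i ∈ Finset.Icc 1 (n - 1), unitE n i (i + 1)) p q = if (p : ℕ) + 1 = q then 1 else 0 := by
  rw [Matrix.sum_apply]
  simp only [unitE_apply]
  split_ifs with h
  · rw [Finset.sum_eq_single ((p : ℕ) + 1)]
    · simp [h]
    · intro b _ hb
      rw [if_neg]
      rintro ⟨h1, _⟩
      exact hb h1.symm
    · intro hp
      exact absurd (Finset.mem_Icc.2 ⟨by omega, by omega⟩) hp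
  · refine Finset.sum_eq_zero fun i hi => if_neg ?_
    rintro ⟨h1, h2⟩
    omega

/-- With rows grouped into complementary pairs and columns as in `colEquiv`, `V` is a direct sum of
$2\times2$ blocks: a Hadamard matrix for $k=0$ and the identity otherwise. Counting from 0, the
columns paired are $k$ and $2n-k$ for $k\ne0$, and $0$ and $n$ for $k=0$; negation in `Fin n` covers
both cases because $-0=0$. -/
theorem V_eq_reindex {N : ℕ} (hN : 2 ≤ N) :
    V hN = Matrix.reindex (pairEquiv hN) (colEquiv hN) (Matrix.fromBlocks
      (Matrix.diagonal fun k : Fin (2 ^ (N - 1)) => if k = 0 then ((1 / √2 : ℝ) : ℂ) else 1)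
      (Matrix.diagonal fun k : Fin (2 ^ (N - 1)) => if k = 0 then ((1 / √2 : ℝ) : ℂ) else 0)
      (Matrix.diagonal fun k : Fin (2 ^ (N - 1)) => if k = 0 then ((1 / √2 : ℝ) : ℂ) else 0)
      (Matrix.diagonal fun k : Fin (2 ^ (N - 1)) =>
        if k = 0 then -((1 / √2 : ℝ) : ℂ) else 1)) := by
  ext i j
  obtain ⟨x, rfl⟩ := (pairEquiv hN).surjective i
  obtain ⟨y, rfl⟩ := (colEquiv hN).surjective j
  have hx : (halfEquiv hN).symm (pairEquiv hN x) = Sum.map id Fin.rev x := by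
    rw [Equiv.symm_apply_eq]
    rcases x with x | x <;> rfl
  have hy : (halfEquiv hN).symm (colEquiv hN y) = Sum.map id Neg.neg y := by
    rw [Equiv.symm_apply_eq]
    rcases y with y | y <;> rfl
  change ((Matrix.reindex (halfEquiv hN) (halfEquiv hN)) _) _ _ = _
  simp only [Matrix.reindex_apply, Matrix.submatrix_apply, Equiv.symm_apply_apply, hx, hy]
  have h0 : ∀ k : Fin (2 ^ (N - 1)), (k : ℕ) = 0 ↔ k = 0 := fun k => by
    rw [Fin.ext_iff]; rfl
  generalize ((1 / √2 : ℝ) : ℂ) = w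
  rcases x with x | x <;> rcases y with y | y
  · simp only [Sum.map_inl, Matrix.fromBlocks_apply₁₁, Matrix.diagonal_apply, Matrix.add_apply,
      sum_unitE_diag, Matrix.smul_apply, unitE_apply, id, smul_eq_mul,
      Nat.add_eq_right, h0]
    by_cases hxy : x = y
    · subst hxy
      by_cases hx : x = 0 <;> simp [hx]
    · have : ¬ (x = 0 ∧ y = 0) := fun h => hxy (h.1.trans h.2.symm)
      simp [hxy, this]
  · simp only [Sum.map_inl, Sum.map_inr, Matrix.fromBlocks_apply₁₂, Matrix.diagonal_apply,
      Matrix.smul_apply, unitE_apply, id, smul_eq_mul, Nat.add_eq_right, h0, neg_eq_zero]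
    by_cases hxy : x = y
    · subst hxy
      by_cases hx : x = 0 <;> simp [hx]
    · have : ¬ (x = 0 ∧ y = 0) := fun h => hxy (h.1.trans h.2.symm)
      simp [hxy, this]
  · have hr : ((x.rev : ℕ) + 1 = 2 ^ (N - 1)) ↔ x = 0 := by
      rw [Fin.val_rev, ← h0]; omega
    simp only [Sum.map_inl, Sum.map_inr, Matrix.fromBlocks_apply₂₁, Matrix.diagonal_apply,
      Matrix.smul_apply, unitE_apply, id, smul_eq_mul, Nat.add_eq_right, h0, hr]
    by_cases hxy : x = y
    · subst hxy
      by_cases hx : x = 0 <;> simp [hx]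
    · have : ¬ (x = 0 ∧ y = 0) := fun h => hxy (h.1.trans h.2.symm)
      simp [hxy, this]
  · have hr : ((x.rev : ℕ) + 1 = 2 ^ (N - 1)) ↔ x = 0 := by
      rw [Fin.val_rev, ← h0]; omega
    have hs : ((x.rev : ℕ) + 1 = (-y : Fin (2 ^ (N - 1)))) ↔ x = y ∧ x ≠ 0 := by
      rw [Fin.val_rev]
      by_cases hy : y = 0
      · subst hy
        simp
      · rw [val_neg_of_ne_zero hy, ne_eq, ← h0 x, Fin.ext_iff]
        rw [← h0] at hy
        omega
    simp only [Sum.map_inr, Matrix.fromBlocks_apply₂₂, Matrix.diagonal_apply, Matrix.add_apply,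
      Matrix.neg_apply, sum_unitE_shift,
      Matrix.smul_apply, unitE_apply, smul_eq_mul, Nat.add_eq_right, h0, hr, hs,
      neg_eq_zero]
    by_cases hxy : x = y
    · subst hxy
      by_cases hx : x = 0 <;> simp [hx]
    · have : ¬ (x = 0 ∧ y = 0) := fun h => hxy (h.1.trans h.2.symm)
      simp [hxy, this]

theorem V_mul_Lam_mul_conjTranspose {N : ℕ} (hN : 2 ≤ N) (lam : ℕ → ℝ) :
    V hN * Lam N lam * (V hN).conjTranspose = rhoOpt hN lam := by
  have hL : Lam N lam = Matrix.reindex (colEquiv hN) (colEquiv hN) (Matrix.fromBlocks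
      (Matrix.diagonal fun k : Fin (2 ^ (N - 1)) => (lam (colEquiv hN (Sum.inl k) + 1) : ℂ)) 0 0
      (Matrix.diagonal fun k : Fin (2 ^ (N - 1)) => (lam (colEquiv hN (Sum.inr k) + 1) : ℂ))) := by
    rw [Matrix.fromBlocks_diagonal, Matrix.reindex_apply, Matrix.submatrix_diagonal_equiv, Lam]
    congr 1
    funext i
    obtain ⟨x, rfl⟩ := (colEquiv hN).surjective i
    rcases x with x | x <;> simp
  rw [hL, V_eq_reindex, rhoOpt, xMatrix_eq_reindex]
  simp only [Matrix.reindex_apply, Matrix.conjTranspose_submatrix, Matrix.submatrix_mul_equiv]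
  congr 1
  rw [Matrix.fromBlocks_conjTranspose, Matrix.fromBlocks_multiply, Matrix.fromBlocks_multiply]
  simp only [Matrix.diagonal_conjTranspose, Matrix.diagonal_mul_diagonal, Matrix.diagonal_add,
    Matrix.mul_zero, add_zero, zero_add]
  have h2 : ((1 / √2 : ℝ) : ℂ) * ((1 / √2 : ℝ) : ℂ) = 1 / 2 := by
    rw [← Complex.ofReal_mul]
    have : (1 / √2 : ℝ) * (1 / √2) = 1 / 2 := by
      rw [div_mul_div_comm, Real.mul_self_sqrt (by norm_num)]; norm_num
    rw [this]; norm_num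
  have hw : star ((1 / √2 : ℝ) : ℂ) = ((1 / √2 : ℝ) : ℂ) := Complex.conj_ofReal _
  revert h2 hw
  generalize ((1 / √2 : ℝ) : ℂ) = w
  intro h2 hw
  have hk1 : ∀ k : Fin (2 ^ (N - 1)), (k : ℕ) + 1 = 1 ↔ k = 0 := fun k => by
    rw [Fin.ext_iff, Nat.add_eq_right]; rfl
  congr 1
  all_goals
    congr 1
    funext k
    by_cases hk : k = 0
    · subst hk
      simp only [colEquiv_inl_val, colEquiv_inr_val, Pi.star_apply, if_true, star_neg, hw, hk1,
        neg_zero, antiEntry, Complex.ofReal_zero, mul_zero, Complex.exp_zero, mul_one]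
      simp
      first
        | linear_combination (lam 1 + lam (2 ^ (N - 1) + 1) : ℂ) * h2
        | linear_combination (lam 1 - lam (2 ^ (N - 1) + 1) : ℂ) * h2
    · simp only [colEquiv_inl_val, colEquiv_inr_val, Pi.star_apply, hk, if_false, hk1, antiEntry,
        val_neg_of_ne_zero hk]
      have : 2 ^ (N - 1) + (2 ^ (N - 1) - (k : ℕ)) + 1 = 2 * 2 ^ (N - 1) + 2 - (k + 1) := by omega
      simp [this]

/-- For the constant sequence 1, the identity $V\Lambda V^\dagger=\rho'_\Lambda$ becomes
$VV^\dagger=1$, so unitarity of `V` needs no separate computation. -/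
theorem rhoOpt_one {N : ℕ} (hN : 2 ≤ N) : rhoOpt hN (fun _ => 1) = 1 := by
  rw [rhoOpt, xMatrix_eq_reindex]
  simp [antiEntry, Matrix.reindex_apply]

theorem V_mem_unitaryGroup {N : ℕ} (hN : 2 ≤ N) :
    V hN ∈ Matrix.unitaryGroup (Fin (2 ^ N)) ℂ := by
  rw [Matrix.mem_unitaryGroup_iff]
  have h := V_mul_Lam_mul_conjTranspose hN (fun _ => 1)
  have h1 : Lam N (fun _ => 1) = 1 := by simp [Lam]
  rwa [h1, mul_one, rhoOpt_one] at h

theorem hasSpectrum_rhoOpt {N : ℕ} (hN : 2 ≤ N) (lam : ℕ → ℝ) :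
    HasSpectrum (rhoOpt hN lam) lam := by
  rw [← V_mul_Lam_mul_conjTranspose, hasSpectrum_conj_unitary (V_mem_unitaryGroup hN)]
  exact hasSpectrum_Lam N lam

theorem trace_xMatrix {N : ℕ} (hN : 2 ≤ N) (a b r φ : ℕ → ℝ) :
    (xMatrix hN a b r φ).trace =
      ((∑ k ∈ Finset.Icc 1 (2 ^ (N - 1)), (a k + b k) : ℝ) : ℂ) := by
  rw [xMatrix_eq_reindex, Matrix.reindex_apply, Matrix.trace,
    ← (pairEquiv hN).sum_comp, Fintype.sum_sum_type, sum_Icc_one_eq_sum_fin,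
    Finset.sum_add_distrib]
  simp

theorem trace_rhoOpt {N : ℕ} (hN : 2 ≤ N) (lam : ℕ → ℝ) :
    (rhoOpt hN lam).trace = ((∑ k ∈ Finset.Icc 1 (2 ^ N), lam k : ℝ) : ℂ) := by
  have hV : (V hN).conjTranspose * V hN = 1 :=
    Matrix.mem_unitaryGroup_iff'.1 (V_mem_unitaryGroup hN)
  rw [← V_mul_Lam_mul_conjTranspose, Matrix.trace_mul_comm, ← mul_assoc, hV, one_mul, Lam,
    Matrix.trace_diagonal, sum_Icc_one_eq_sum_fin, Complex.ofReal_sum]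

theorem isXDensity_rhoOpt {N : ℕ} (hN : 2 ≤ N) (lam : ℕ → ℝ)
    (hanti : AntitoneOn lam (Set.Icc 1 (2 ^ N)))
    (hnonneg : ∀ k ∈ Set.Icc 1 (2 ^ N), 0 ≤ lam k)
    (hsum : ∑ k ∈ Finset.Icc 1 (2 ^ N), lam k = 1) : IsXDensity hN (rhoOpt hN lam) := by
  -- The normalization of the parameters is read off from the trace, known by unitary invariance.
  have ht := trace_rhoOpt hN lam
  rw [hsum] at ht
  unfold rhoOpt at ht
  rw [trace_xMatrix] at ht
  unfold rhoOpt
  have h2 := two_mul_half hN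
  have hpos : 0 < 2 ^ (N - 1) := by positivity
  refine ⟨_, _, _, _, ?_, Complex.ofReal_injective ht, rfl⟩
  intro k hk
  rw [Finset.mem_Icc] at hk
  have hp := Real.pi_pos
  have l1 := hnonneg 1 ⟨le_refl _, by omega⟩
  have ln := hnonneg (2 ^ (N - 1) + 1) ⟨by omega, by omega⟩
  have hle : lam (2 ^ (N - 1) + 1) ≤ lam 1 :=
    hanti ⟨le_refl _, by omega⟩ ⟨by omega, by omega⟩ (by omega)
  by_cases h : k = 1
  · simp only [h, if_true]
    refine ⟨by linarith, by linarith, by linarith, ?_, le_refl _, by linarith⟩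
    rw [Real.sqrt_mul_self (by linarith)]
    linarith
  · simp only [h, if_false]
    exact ⟨hnonneg k ⟨by omega, by omega⟩, hnonneg _ ⟨by omega, by omega⟩, le_refl _,
      Real.sqrt_nonneg _, le_refl _, by linarith⟩

/-- The spectral theorem lists the eigenvalues in its own order. The multisets agree, so permuting
the columns of the eigenvector matrix by a matching bijection produces the prescribed order. -/
theorem exists_diagonalizes {N : ℕ} (ρ : QMat N) (lam : ℕ → ℝ) (hρ : IsDensity ρ)
    (hs : HasSpectrum ρ lam) : ∃ Φ : QMat N, Diagonalizes Φ ρ lam := by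
  have hH := hρ.1.isHermitian
  rw [hasSpectrum_iff, hH.roots_charpoly_eq_eigenvalues] at hs
  obtain ⟨σ, hσ⟩ := exists_equiv_of_map_univ_eq _ _ hs.symm
  have hL : Lam N lam = (Matrix.diagonal
      ((RCLike.ofReal : ℝ → ℂ) ∘ hH.eigenvalues)).submatrix σ σ := by
    rw [Matrix.submatrix_diagonal_equiv, Lam]
    exact congrArg _ (funext fun i => (hσ i).symm)
  refine ⟨(hH.eigenvectorUnitary : QMat N).submatrix id σ, ?_, ?_⟩
  · rw [Matrix.mem_unitaryGroup_iff, Matrix.star_eq_conjTranspose, Matrix.conjTranspose_submatrix,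
      Matrix.submatrix_mul_equiv]
    have h : (hH.eigenvectorUnitary : QMat N) * (hH.eigenvectorUnitary : QMat N).conjTranspose
      = 1 := Matrix.mem_unitaryGroup_iff.1 hH.eigenvectorUnitary.2
    rw [h, Matrix.submatrix_id_id]
  · rw [hL, Matrix.conjTranspose_submatrix, Matrix.submatrix_mul_equiv,
      Matrix.submatrix_mul_equiv, Matrix.submatrix_id_id]
    exact hH.spectral_theorem

/-! ### Purity of a reduced pure state -/

/-- The squared concurrence of the bipartite vector with amplitude matrix `M`, in a form that is
homogeneous of degree four. -/
def tangle {m n : Type*} [Fintype m] [Fintype n] [DecidableEq m] (M : Matrix m n ℂ) : ℝ :=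
  2 * ((M * M.conjTranspose).trace.re ^ 2 - ((M * M.conjTranspose) ^ 2).trace.re)

section Tangle

variable {m n : Type*} [Fintype m] [Fintype n]

theorem trace_mul_conjTranspose (M : Matrix m n ℂ) :
    (M * M.conjTranspose).trace = ((∑ s, ∑ t, ‖M s t‖ ^ 2 : ℝ) : ℂ) := by
  simp only [Matrix.trace, Matrix.diag_apply, Matrix.mul_apply, Matrix.conjTranspose_apply,
    Complex.ofReal_sum]
  refine Finset.sum_congr rfl fun s _ => Finset.sum_congr rfl fun t _ => ?_
  rw [Complex.star_def, Complex.mul_conj, Complex.normSq_eq_norm_sq]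

variable [DecidableEq m]

/-- Lagrange's identity: after symmetrization in the two column indices, each summand of
$2((\mathrm{tr}\,MM^\dagger)^2-\mathrm{tr}(MM^\dagger)^2)$ is the squared modulus of a $2\times2$
minor. -/
theorem tangle_eq_sum_minors (M : Matrix m n ℂ) :
    tangle M = ∑ s, ∑ s', ∑ t, ∑ t', ‖M s t * M s' t' - M s t' * M s' t‖ ^ 2 := by
  have hP : (M * M.conjTranspose).trace ^ 2 = ∑ s, ∑ s', ∑ t, ∑ t',
      M s t * star (M s t) * (M s' t' * star (M s' t')) := by
    simp only [sq, Matrix.trace, Matrix.diag_apply, Matrix.mul_apply, Matrix.conjTranspose_apply,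
      Finset.sum_mul_sum]
  have hT : ((M * M.conjTranspose) ^ 2).trace = ∑ s, ∑ s', ∑ t, ∑ t',
      M s t * star (M s' t) * (M s' t' * star (M s t')) := by
    simp only [sq, Matrix.trace, Matrix.diag_apply, Matrix.mul_apply, Matrix.conjTranspose_apply,
      Finset.sum_mul_sum]
  have hre : (M * M.conjTranspose).trace.re ^ 2 = ((M * M.conjTranspose).trace ^ 2).re := by
    rw [trace_mul_conjTranspose, Complex.ofReal_re, ← Complex.ofReal_pow, Complex.ofReal_re]
  have key : 2 * ((M * M.conjTranspose).trace ^ 2 - ((M * M.conjTranspose) ^ 2).trace) =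
      ((∑ s, ∑ s', ∑ t, ∑ t', ‖M s t * M s' t' - M s t' * M s' t‖ ^ 2 : ℝ) : ℂ) := by
    rw [hP, hT]
    simp only [Complex.ofReal_sum, Finset.mul_sum, ← Finset.sum_sub_distrib]
    refine Finset.sum_congr rfl fun s _ => Finset.sum_congr rfl fun s' _ => ?_
    have hsw : ∀ f : n → n → ℂ, ∑ t, ∑ t', f t t' = ∑ t, ∑ t', (f t t' + f t' t) / 2 := by
      intro f
      have h := Finset.sum_comm (s := Finset.univ) (t := Finset.univ) (f := f)
      simp only [← Finset.sum_div, Finset.sum_add_distrib]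
      rw [← h]
      ring
    rw [hsw]
    refine Finset.sum_congr rfl fun t _ => Finset.sum_congr rfl fun t' _ => ?_
    rw [← Complex.normSq_eq_norm_sq, ← Complex.mul_conj]
    simp only [map_sub, map_mul, Complex.star_def]
    ring
  rw [tangle, hre, ← Complex.sub_re, ← Complex.ofReal_re (∑ s, ∑ s', ∑ t, ∑ t', _), ← key]
  simp

theorem tangle_smul (c : ℂ) (M : Matrix m n ℂ) : tangle (c • M) = (‖c‖ ^ 2) ^ 2 * tangle M := by
  have : ∀ s s' t t', (c • M) s t * (c • M) s' t' - (c • M) s t' * (c • M) s' t =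
      c ^ 2 * (M s t * M s' t' - M s t' * M s' t) := by
    intro s s' t t'
    simp only [Matrix.smul_apply, smul_eq_mul]
    ring
  simp only [tangle_eq_sum_minors, this, norm_mul, norm_pow, mul_pow, Finset.mul_sum]

theorem tangle_vecMulVec (x : m → ℂ) (y : n → ℂ) : tangle (Matrix.vecMulVec x y) = 0 := by
  rw [tangle_eq_sum_minors]
  have : ∀ s s' t t', Matrix.vecMulVec x y s t * Matrix.vecMulVec x y s' t' -
      Matrix.vecMulVec x y s t' * Matrix.vecMulVec x y s' t = 0 := by
    intro s s' t t'
    simp only [Matrix.vecMulVec_apply]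
    ring
  simp [this]

theorem tangle_mul_mul [DecidableEq n] (M : Matrix m n ℂ) {P : Matrix m m ℂ} {Q : Matrix n n ℂ}
    (hP : P ∈ Matrix.unitaryGroup m ℂ) (hQ : Q ∈ Matrix.unitaryGroup n ℂ) :
    tangle (P * M * Q) = tangle M := by
  have hQ' : Q * Q.conjTranspose = 1 := Matrix.mem_unitaryGroup_iff.1 hQ
  have hP' : P.conjTranspose * P = 1 := Matrix.mem_unitaryGroup_iff'.1 hP
  have h : P * M * Q * (P * M * Q).conjTranspose =
      P * (M * M.conjTranspose) * P.conjTranspose := by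
    rw [Matrix.conjTranspose_mul, Matrix.conjTranspose_mul, Matrix.mul_assoc (P * M),
      ← Matrix.mul_assoc Q, hQ', Matrix.one_mul]
    simp only [Matrix.mul_assoc]
  have ht : ∀ X : Matrix m m ℂ, (P * X * P.conjTranspose).trace = X.trace := by
    intro X
    rw [Matrix.trace_mul_comm, ← Matrix.mul_assoc, hP', Matrix.one_mul]
  have h2 : (P * (M * M.conjTranspose) * P.conjTranspose) ^ 2 =
      P * (M * M.conjTranspose) ^ 2 * P.conjTranspose := by
    rw [sq, sq]
    simp only [Matrix.mul_assoc]
    rw [← Matrix.mul_assoc P.conjTranspose P, hP', Matrix.one_mul]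
  rw [tangle, tangle, h, h2, ht, ht]

theorem add_swap_le_sum {ι : Type*} [Fintype ι] [DecidableEq ι] (g : ι → ι → ℝ)
    (hg : ∀ i j, 0 ≤ g i j) {a b : ι} (hab : a ≠ b) : g a b + g b a ≤ ∑ i, ∑ j, g i j := by
  have h : ∑ i ∈ {a, b}, ∑ j, g i j ≤ ∑ i, ∑ j, g i j :=
    Finset.sum_le_sum_of_subset_of_nonneg (Finset.subset_univ _)
      fun i _ _ => Finset.sum_nonneg fun j _ => hg i j
  rw [Finset.sum_pair hab] at h
  have h1 := Finset.single_le_sum (f := g a) (fun j _ => hg a j) (Finset.mem_univ b)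
  have h2 := Finset.single_le_sum (f := g b) (fun j _ => hg b j) (Finset.mem_univ a)
  linarith

/-- Exchanging the rows or the columns only changes the sign of a minor, so each one occurs four
times in the sum of squares. -/
theorem two_mul_norm_minor_le_sqrt_tangle [DecidableEq n] (M : Matrix m n ℂ) {s s' : m} {t t' : n}
    (hs : s ≠ s') (ht : t ≠ t') :
    2 * ‖M s t * M s' t' - M s t' * M s' t‖ ≤ √(tangle M) := by
  apply Real.le_sqrt_of_sq_le
  rw [tangle_eq_sum_minors]
  have h1 := add_swap_le_sum (fun s s' => ∑ t, ∑ t', ‖M s t * M s' t' - M s t' * M s' t‖ ^ 2)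
    (fun _ _ => by positivity) hs
  have h2 := add_swap_le_sum (fun t t' => ‖M s t * M s' t' - M s t' * M s' t‖ ^ 2)
    (fun _ _ => by positivity) ht
  have h3 := add_swap_le_sum (fun t t' => ‖M s' t * M s t' - M s' t' * M s t‖ ^ 2)
    (fun _ _ => by positivity) ht
  beta_reduce at h1 h2 h3
  have e1 : ‖M s t' * M s' t - M s t * M s' t'‖ = ‖M s t * M s' t' - M s t' * M s' t‖ :=
    norm_sub_rev _ _
  have e2 : ‖M s' t * M s t' - M s' t' * M s t‖ = ‖M s t * M s' t' - M s t' * M s' t‖ := by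
    rw [← norm_neg]; congr 1; ring
  have e3 : ‖M s' t' * M s t - M s' t * M s t'‖ = ‖M s t * M s' t' - M s t' * M s' t‖ := by
    congr 1; ring
  rw [e1] at h2
  rw [e2, e3] at h3
  linarith

theorem tangle_single_add_single [DecidableEq n] {s s' : m} {t t' : n} (hs : s ≠ s') (ht : t ≠ t')
    (α β : ℂ) :
    tangle (Matrix.single s t α + Matrix.single s' t' β) = (2 * (‖α‖ * ‖β‖)) ^ 2 := by
  have h : (Matrix.single s t α + Matrix.single s' t' β) *
      (Matrix.single s t α + Matrix.single s' t' β).conjTranspose =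
      Matrix.single s s ((‖α‖ ^ 2 : ℝ) : ℂ) + Matrix.single s' s' ((‖β‖ ^ 2 : ℝ) : ℂ) := by
    simp only [Matrix.conjTranspose_add, Matrix.conjTranspose_single, Matrix.mul_add,
      Matrix.add_mul, Matrix.single_mul_single_same, Matrix.single_mul_single_of_ne _ _ _ _ ht,
      Matrix.single_mul_single_of_ne _ _ _ _ ht.symm, add_zero, zero_add, Complex.star_def,
      Complex.mul_conj, Complex.normSq_eq_norm_sq]
  rw [tangle, h, sq (_ + _)]
  simp only [Matrix.mul_add, Matrix.add_mul, Matrix.single_mul_single_same,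
    Matrix.single_mul_single_of_ne _ _ _ _ hs, Matrix.single_mul_single_of_ne _ _ _ _ hs.symm,
    add_zero, zero_add, Matrix.trace_add, Matrix.trace_single_eq_same, Complex.add_re,
    Complex.ofReal_re, ← Complex.ofReal_mul]
  ring

end Tangle

/-- The basis as a product of the configurations on `A` and off `A`. -/
def glueEquiv {N : ℕ} (A : Finset (Fin N)) :
    ({k // k ∈ A} → Fin 2) × ({k // k ∉ A} → Fin 2) ≃ Fin (2 ^ N) :=
  (Equiv.piEquivPiSubtypeProd (fun k => k ∈ A) fun _ => Fin 2).symm.trans (bits N).symm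

theorem glueEquiv_apply {N : ℕ} (A : Finset (Fin N)) (s : {k // k ∈ A} → Fin 2)
    (t : {k // k ∉ A} → Fin 2) : glueEquiv A (s, t) = glue A s t := rfl

theorem bits_glue {N : ℕ} (A : Finset (Fin N)) (s : {k // k ∈ A} → Fin 2)
    (t : {k // k ∉ A} → Fin 2) (k : Fin N) :
    bits N (glue A s t) k = if h : k ∈ A then s ⟨k, h⟩ else t ⟨k, h⟩ := by
  rw [glue, Equiv.apply_symm_apply]
  rfl

theorem glue_rev {N : ℕ} (A : Finset (Fin N)) (s : {k // k ∈ A} → Fin 2)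
    (t : {k // k ∉ A} → Fin 2) :
    glue A (fun k => (s k).rev) (fun k => (t k).rev) = (glue A s t).rev := by
  apply (bits N).injective
  funext k
  rw [bits_rev, bits_glue, bits_glue]
  split_ifs <;> rfl

/-- The amplitudes of `ψ` as a matrix, for the bipartition `A | Aᶜ`. -/
def amp {N : ℕ} (A : Finset (Fin N)) (ψ : Fin (2 ^ N) → ℂ) :
    Matrix ({k // k ∈ A} → Fin 2) ({k // k ∉ A} → Fin 2) ℂ :=
  Matrix.of fun s t => ψ (glue A s t)

theorem amp_add {N : ℕ} (A : Finset (Fin N)) (ψ χ : Fin (2 ^ N) → ℂ) :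
    amp A (ψ + χ) = amp A ψ + amp A χ := rfl

theorem amp_smul {N : ℕ} (A : Finset (Fin N)) (c : ℂ) (ψ : Fin (2 ^ N) → ℂ) :
    amp A (c • ψ) = c • amp A ψ := rfl

theorem amp_single {N : ℕ} (A : Finset (Fin N)) (s : {k // k ∈ A} → Fin 2)
    (t : {k // k ∉ A} → Fin 2) (c : ℂ) :
    amp A (Pi.single (glue A s t) c) = Matrix.single s t c := by
  ext s' t'
  have h : glue A s' t' = glue A s t ↔ s = s' ∧ t = t' := by
    rw [← glueEquiv_apply, ← glueEquiv_apply, (glueEquiv A).injective.eq_iff, Prod.ext_iff]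
    constructor <;> rintro ⟨h1, h2⟩ <;> exact ⟨h1.symm, h2.symm⟩
  simp only [amp, Matrix.of_apply, Pi.single_apply, Matrix.single_apply, h]

theorem reduced_ketbra {N : ℕ} (A : Finset (Fin N)) (ψ : Fin (2 ^ N) → ℂ) :
    reduced A (ketbra ψ) = amp A ψ * (amp A ψ).conjTranspose := by
  ext s s'
  simp [reduced, ketbra, amp, Matrix.mul_apply, Matrix.vecMulVec_apply]

theorem sum_norm_amp {N : ℕ} (A : Finset (Fin N)) (ψ : Fin (2 ^ N) → ℂ) :
    ∑ s, ∑ t, ‖amp A ψ s t‖ ^ 2 = ∑ j, ‖ψ j‖ ^ 2 := by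
  rw [← (glueEquiv A).sum_comp, Fintype.sum_prod_type]
  rfl

theorem sqrt_two_mul_eq_sqrt_tangle {N : ℕ} (A : Finset (Fin N)) (ψ : Fin (2 ^ N) → ℂ)
    (hψ : ∑ j, ‖ψ j‖ ^ 2 = 1) :
    √2 * √(1 - (reduced A (ketbra ψ) ^ 2).trace.re) = √(tangle (amp A ψ)) := by
  rw [tangle, trace_mul_conjTranspose, sum_norm_amp, hψ, reduced_ketbra, Complex.ofReal_re,
    one_pow, Real.sqrt_mul (by norm_num)]

theorem pureCGM_eq {N : ℕ} (ψ : Fin (2 ^ N) → ℂ) (hψ : ∑ j, ‖ψ j‖ ^ 2 = 1) :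
    pureCGM ψ = ⨅ A : Bipartition N, √(tangle (amp A.1 ψ)) :=
  iInf_congr fun A => sqrt_two_mul_eq_sqrt_tangle A.1 ψ hψ

theorem pureCGM_nonneg {N : ℕ} (ψ : Fin (2 ^ N) → ℂ) : 0 ≤ pureCGM ψ :=
  Real.iInf_nonneg fun _ => by positivity

theorem pureCGM_le {N : ℕ} (A : Bipartition N) (ψ : Fin (2 ^ N) → ℂ) (hψ : ∑ j, ‖ψ j‖ ^ 2 = 1) :
    pureCGM ψ ≤ √(tangle (amp A.1 ψ)) := by
  rw [pureCGM_eq ψ hψ]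
  exact ciInf_le ⟨0, by rintro _ ⟨B, rfl⟩; exact Real.sqrt_nonneg _⟩ A

theorem nonempty_bipartition {N : ℕ} (hN : 2 ≤ N) : Nonempty (Bipartition N) :=
  ⟨⟨{⟨0, by omega⟩}, Finset.singleton_nonempty _, ⟨⟨1, by omega⟩, by
    rw [Finset.mem_compl, Finset.mem_singleton, Fin.mk.injEq]
    exact one_ne_zero⟩⟩⟩

/-! ### Local unitary invariance -/

/-- The tensor product of the single-qubit operators `U k`, indexed by configurations. -/
def tensorOp {κ : Type*} [Fintype κ] (U : κ → Matrix (Fin 2) (Fin 2) ℂ) :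
    Matrix (κ → Fin 2) (κ → Fin 2) ℂ :=
  Matrix.of fun s s' => ∏ k, U k (s k) (s' k)

section TensorOp

variable {κ : Type*} [Fintype κ]

theorem tensorOp_conjTranspose (U : κ → Matrix (Fin 2) (Fin 2) ℂ) :
    (tensorOp U).conjTranspose = tensorOp fun k => (U k).conjTranspose := by
  ext s s'
  simp only [tensorOp, Matrix.conjTranspose_apply, Matrix.of_apply, Complex.star_def, map_prod]

theorem tensorOp_one : tensorOp (fun _ : κ => (1 : Matrix (Fin 2) (Fin 2) ℂ)) = 1 := by
  ext s s'
  simp only [tensorOp, Matrix.of_apply, Matrix.one_apply, Finset.prod_ite_zero, funext_iff]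
  simp

variable [DecidableEq κ]

theorem tensorOp_mul (U W : κ → Matrix (Fin 2) (Fin 2) ℂ) :
    tensorOp U * tensorOp W = tensorOp fun k => U k * W k := by
  ext s s'
  simp only [tensorOp, Matrix.mul_apply, Matrix.of_apply, Finset.prod_univ_sum,
    Fintype.piFinset_univ, Finset.prod_mul_distrib]

theorem tensorOp_mem_unitaryGroup {U : κ → Matrix (Fin 2) (Fin 2) ℂ}
    (hU : ∀ k, U k ∈ Matrix.unitaryGroup (Fin 2) ℂ) :
    tensorOp U ∈ Matrix.unitaryGroup (κ → Fin 2) ℂ := by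
  rw [Matrix.mem_unitaryGroup_iff, Matrix.star_eq_conjTranspose, tensorOp_conjTranspose,
    tensorOp_mul, ← tensorOp_one]
  congr 1
  funext k
  exact Matrix.mem_unitaryGroup_iff.1 (hU k)

end TensorOp

theorem localOp_eq_submatrix {N : ℕ} (U : Fin N → Matrix (Fin 2) (Fin 2) ℂ) :
    localOp U = (tensorOp U).submatrix (bits N) (bits N) := rfl

theorem localOp_conjTranspose {N : ℕ} (U : Fin N → Matrix (Fin 2) (Fin 2) ℂ) :
    (localOp U).conjTranspose = localOp fun k => (U k).conjTranspose := by
  rw [localOp_eq_submatrix, Matrix.conjTranspose_submatrix, tensorOp_conjTranspose,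
    localOp_eq_submatrix]

theorem localOp_mem_unitaryGroup {N : ℕ} {U : Fin N → Matrix (Fin 2) (Fin 2) ℂ}
    (hU : ∀ k, U k ∈ Matrix.unitaryGroup (Fin 2) ℂ) :
    localOp U ∈ Matrix.unitaryGroup (Fin (2 ^ N)) ℂ := by
  have h : tensorOp U * (tensorOp U).conjTranspose = 1 :=
    Matrix.mem_unitaryGroup_iff.1 (tensorOp_mem_unitaryGroup hU)
  rw [Matrix.mem_unitaryGroup_iff, Matrix.star_eq_conjTranspose, localOp_eq_submatrix,
    Matrix.conjTranspose_submatrix, Matrix.submatrix_mul_equiv, h, Matrix.submatrix_one_equiv]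

theorem amp_localOp {N : ℕ} (A : Finset (Fin N)) (U : Fin N → Matrix (Fin 2) (Fin 2) ℂ)
    (ψ : Fin (2 ^ N) → ℂ) :
    amp A ((localOp U).mulVec ψ) = tensorOp (fun k : {k // k ∈ A} => U k) * amp A ψ *
      (tensorOp fun k : {k // k ∉ A} => U k).transpose := by
  ext s t
  have h : ∀ s' t', localOp U (glue A s t) (glue A s' t') =
      tensorOp (fun k : {k // k ∈ A} => U k) s s' *
        tensorOp (fun k : {k // k ∉ A} => U k) t t' := by
    intro s' t'
    rw [localOp, Matrix.of_apply, ← Fintype.prod_subtype_mul_prod_subtype (fun k => k ∈ A)]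
    rw [tensorOp, tensorOp, Matrix.of_apply, Matrix.of_apply]
    congr 1
    · refine Finset.prod_congr (Finset.ext fun _ => by simp) fun k _ => ?_
      rw [bits_glue, bits_glue, dif_pos k.2, dif_pos k.2]
    · refine Finset.prod_congr rfl fun k _ => ?_
      rw [bits_glue, bits_glue, dif_neg k.2, dif_neg k.2]
  rw [amp, Matrix.of_apply, Matrix.mulVec, dotProduct, ← (glueEquiv A).sum_comp,
    Fintype.sum_prod_type, Finset.sum_comm]
  simp only [Matrix.mul_apply, Matrix.transpose_apply, Finset.sum_mul, glueEquiv_apply, h, amp,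
    Matrix.of_apply]
  refine Finset.sum_congr rfl fun t' _ => Finset.sum_congr rfl fun s' _ => ?_
  ring

theorem tangle_amp_localOp {N : ℕ} (A : Finset (Fin N)) {U : Fin N → Matrix (Fin 2) (Fin 2) ℂ}
    (hU : ∀ k, U k ∈ Matrix.unitaryGroup (Fin 2) ℂ) (ψ : Fin (2 ^ N) → ℂ) :
    tangle (amp A ((localOp U).mulVec ψ)) = tangle (amp A ψ) := by
  rw [amp_localOp]
  refine tangle_mul_mul _ (tensorOp_mem_unitaryGroup fun k => hU k) ?_
  have h : tensorOp (fun k : {k // k ∉ A} => U k) ∈ Matrix.unitaryGroup _ ℂ :=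
    tensorOp_mem_unitaryGroup fun k => hU k
  have h1 : (tensorOp fun k : {k // k ∉ A} => U k).conjTranspose *
      (tensorOp fun k : {k // k ∉ A} => U k) = 1 := Matrix.mem_unitaryGroup_iff'.1 h
  rw [Matrix.mem_unitaryGroup_iff, Matrix.star_eq_conjTranspose, ← Matrix.transpose_inj,
    Matrix.transpose_mul, Matrix.transpose_one, Matrix.transpose_transpose]
  exact h1

theorem sum_norm_sq_eq {ι : Type*} [Fintype ι] (ψ : ι → ℂ) :
    ((∑ j, ‖ψ j‖ ^ 2 : ℝ) : ℂ) = dotProduct (star ψ) ψ := by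
  rw [dotProduct, Complex.ofReal_sum]
  refine Finset.sum_congr rfl fun j _ => ?_
  rw [Pi.star_apply, Complex.star_def, mul_comm, Complex.mul_conj, Complex.normSq_eq_norm_sq]

theorem sum_norm_sq_mulVec {ι : Type*} [Fintype ι] [DecidableEq ι] {U : Matrix ι ι ℂ}
    (hU : U ∈ Matrix.unitaryGroup ι ℂ) (ψ : ι → ℂ) :
    ∑ j, ‖U.mulVec ψ j‖ ^ 2 = ∑ j, ‖ψ j‖ ^ 2 := by
  have h : U.conjTranspose * U = 1 := Matrix.mem_unitaryGroup_iff'.1 hU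
  apply Complex.ofReal_injective
  rw [sum_norm_sq_eq, sum_norm_sq_eq, Matrix.star_mulVec, Matrix.dotProduct_mulVec,
    Matrix.vecMul_vecMul, h, Matrix.vecMul_one]

theorem ketbra_mulVec {N : ℕ} (U : QMat N) (ψ : Fin (2 ^ N) → ℂ) :
    ketbra (U.mulVec ψ) = U * ketbra ψ * U.conjTranspose := by
  rw [ketbra, ketbra, Matrix.star_mulVec, Matrix.mul_vecMulVec, Matrix.vecMulVec_mul]

theorem isEnsemble_localOp {N m : ℕ} {U : Fin N → Matrix (Fin 2) (Fin 2) ℂ}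
    (hU : ∀ k, U k ∈ Matrix.unitaryGroup (Fin 2) ℂ) {ρ : QMat N} {p : Fin m → ℝ}
    {ψ : Fin m → Fin (2 ^ N) → ℂ} (h : IsEnsemble ρ p ψ) :
    IsEnsemble (localOp U * ρ * (localOp U).conjTranspose) p
      (fun i => (localOp U).mulVec (ψ i)) := by
  obtain ⟨h1, h2, h3, h4⟩ := h
  refine ⟨h1, h2, fun i => ?_, ?_⟩
  · rw [sum_norm_sq_mulVec (localOp_mem_unitaryGroup hU), h3]
  · rw [h4]
    simp only [Matrix.mul_sum, Matrix.sum_mul, ketbra_mulVec, Matrix.mul_smul, Matrix.smul_mul]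

theorem pureCGM_localOp {N : ℕ} {U : Fin N → Matrix (Fin 2) (Fin 2) ℂ}
    (hU : ∀ k, U k ∈ Matrix.unitaryGroup (Fin 2) ℂ) (ψ : Fin (2 ^ N) → ℂ)
    (hψ : ∑ j, ‖ψ j‖ ^ 2 = 1) : pureCGM ((localOp U).mulVec ψ) = pureCGM ψ := by
  rw [pureCGM_eq _ hψ, pureCGM_eq]
  · exact iInf_congr fun A => by rw [tangle_amp_localOp _ hU]
  · rw [sum_norm_sq_mulVec (localOp_mem_unitaryGroup hU), hψ]

theorem CGM_localOp {N : ℕ} {U : Fin N → Matrix (Fin 2) (Fin 2) ℂ}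
    (hU : ∀ k, U k ∈ Matrix.unitaryGroup (Fin 2) ℂ) (ρ : QMat N) :
    CGM (localOp U * ρ * (localOp U).conjTranspose) = CGM ρ := by
  have key : ∀ {W : Fin N → Matrix (Fin 2) (Fin 2) ℂ}
      (_ : ∀ k, W k ∈ Matrix.unitaryGroup (Fin 2) ℂ) (σ : QMat N) (c : ℝ),
      (∃ (m : ℕ) (p : Fin m → ℝ) (ψ : Fin m → Fin (2 ^ N) → ℂ),
        IsEnsemble σ p ψ ∧ c = ∑ i, p i * pureCGM (ψ i)) →
      (∃ (m : ℕ) (p : Fin m → ℝ) (ψ : Fin m → Fin (2 ^ N) → ℂ),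
        IsEnsemble (localOp W * σ * (localOp W).conjTranspose) p ψ ∧
          c = ∑ i, p i * pureCGM (ψ i)) := by
    rintro W hW σ c ⟨m, p, ψ, h, rfl⟩
    refine ⟨m, p, _, isEnsemble_localOp hW h, Finset.sum_congr rfl fun i _ => ?_⟩
    rw [pureCGM_localOp hW _ (h.2.2.1 i)]
  have hU' : ∀ k, (U k).conjTranspose ∈ Matrix.unitaryGroup (Fin 2) ℂ :=
    fun k => Unitary.star_mem (hU k)
  have hLU : (localOp U).conjTranspose * localOp U = 1 :=
    Matrix.mem_unitaryGroup_iff'.1 (localOp_mem_unitaryGroup hU)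
  rw [CGM, CGM]
  congr 1
  ext c
  refine ⟨fun h => ?_, key hU ρ c⟩
  have hback := key hU' _ c h
  rw [← localOp_conjTranspose, Matrix.conjTranspose_conjTranspose] at hback
  have e : (localOp U).conjTranspose * (localOp U * ρ * (localOp U).conjTranspose) * localOp U
      = ρ := by
    simp only [Matrix.mul_assoc, hLU, Matrix.mul_one]
    rw [← Matrix.mul_assoc, hLU, Matrix.one_mul]
  rwa [e] at hback

/-! ### A lower bound on the GM-concurrence -/

theorem low_zero_eq_glue {N : ℕ} (hN : 2 ≤ N) (A : Finset (Fin N)) :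
    low hN 0 = glue A (fun _ => 0) (fun _ => 0) := by
  apply (bits N).injective
  funext k
  have h : low hN 0 = ⟨0, by positivity⟩ := rfl
  rw [bits_glue, h, bits_zero]
  split_ifs <;> rfl

/-- For any bipartition the concurrence dominates the overlap of the all-zero and the all-one
amplitudes, up to the corresponding products for the other complementary pairs. -/
theorem pair_bound_le_sqrt_tangle {N : ℕ} (hN : 2 ≤ N) (A : Bipartition N)
    (ψ : Fin (2 ^ N) → ℂ) :
    2 * (‖ψ (low hN 0)‖ * ‖ψ (low hN 0).rev‖ -
      ∑ k ∈ Finset.univ.erase 0, ‖ψ (low hN k)‖ * ‖ψ (low hN k).rev‖) ≤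
      √(tangle (amp A.1 ψ)) := by
  obtain ⟨A, ⟨x, hx⟩, ⟨y, hy⟩⟩ := A
  rw [Finset.mem_compl] at hy
  let s : {k // k ∈ A} → Fin 2 := fun _ => 0
  let t : {k // k ∉ A} → Fin 2 := fun _ => 0
  let s' : {k // k ∈ A} → Fin 2 := fun k => (s k).rev
  let t' : {k // k ∉ A} → Fin 2 := fun k => (t k).rev
  have h01 : (0 : Fin 2) ≠ Fin.rev 0 := by decide
  have hs : s ≠ s' := fun h => h01 (congrFun h ⟨x, hx⟩)
  have ht : t ≠ t' := fun h => h01 (congrFun h ⟨y, hy⟩)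
  have hz : glue A s t = low hN 0 := (low_zero_eq_glue hN A).symm
  have hz' : glue A s' t' = (low hN 0).rev := by rw [← hz, ← glue_rev]
  -- The other product in the minor also belongs to a complementary pair. It is not the pair of the
  -- all-zero string, since both parts of the bipartition are nonempty.
  have hw : glue A s' t = (glue A s t').rev := by
    rw [← glue_rev]
    simp [s', t']
  have hinj : ∀ {u u' v v'}, glue A u v = glue A u' v' → u = u' ∧ v = v' := by
    intro u u' v v' h
    exact Prod.ext_iff.1 ((glueEquiv A).injective h)
  have hpair : ‖ψ (glue A s t')‖ * ‖ψ (glue A s t').rev‖ ≤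
      ∑ k ∈ Finset.univ.erase 0, ‖ψ (low hN k)‖ * ‖ψ (low hN k).rev‖ := by
    obtain ⟨k, hk⟩ := exists_low hN (glue A s t')
    have hk0 : k ≠ 0 := by
      rintro rfl
      rcases hk with hk | hk
      · rw [← hz] at hk
        exact ht (hinj hk).2.symm
      · rw [← hz'] at hk
        exact hs (hinj hk).1
    have hle := Finset.single_le_sum (f := fun k => ‖ψ (low hN k)‖ * ‖ψ (low hN k).rev‖)
      (s := Finset.univ.erase 0) (fun _ _ => by positivity)
      (Finset.mem_erase.2 ⟨hk0, Finset.mem_univ k⟩)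
    rcases hk with hk | hk
    · rwa [hk]
    · rw [hk, Fin.rev_rev, mul_comm]
      exact hle
  have hm := two_mul_norm_minor_le_sqrt_tangle (amp A ψ) hs ht
  have e : amp A ψ s t * amp A ψ s' t' - amp A ψ s t' * amp A ψ s' t =
      ψ (low hN 0) * ψ (low hN 0).rev - ψ (glue A s t') * ψ (glue A s t').rev := by
    rw [← hw, ← hz', ← hz]
    rfl
  rw [e] at hm
  have htri := norm_sub_norm_le (ψ (low hN 0) * ψ (low hN 0).rev)
    (ψ (glue A s t') * ψ (glue A s t').rev)
  rw [norm_mul, norm_mul] at htri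
  linarith

theorem pair_bound_le_pureCGM {N : ℕ} (hN : 2 ≤ N) (ψ : Fin (2 ^ N) → ℂ)
    (hψ : ∑ j, ‖ψ j‖ ^ 2 = 1) :
    2 * (‖ψ (low hN 0)‖ * ‖ψ (low hN 0).rev‖ -
      ∑ k ∈ Finset.univ.erase 0, ‖ψ (low hN k)‖ * ‖ψ (low hN k).rev‖) ≤ pureCGM ψ := by
  have := nonempty_bipartition hN
  rw [pureCGM_eq ψ hψ]
  exact le_ciInf fun A => pair_bound_le_sqrt_tangle hN A ψ

theorem ensemble_apply {N m : ℕ} (p : Fin m → ℝ) (ψ : Fin m → Fin (2 ^ N) → ℂ)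
    (i j : Fin (2 ^ N)) : (∑ l, (p l : ℂ) • ketbra (ψ l)) i j =
      ∑ l, (p l : ℂ) * (ψ l i * star (ψ l j)) := by
  rw [Matrix.sum_apply]
  rfl

/-- The bound for pure states is averaged over an ensemble: the triangle inequality handles the
coherence of pair 0, and Cauchy–Schwarz bounds the averages of the other products by the diagonal
entries. An ensemble must exist, because the infimum of the empty set is 0 by convention. -/
theorem le_CGM {N : ℕ} (hN : 2 ≤ N) (ρ : QMat N)
    (hρ : ∃ (m : ℕ) (p : Fin m → ℝ) (ψ : Fin m → Fin (2 ^ N) → ℂ), IsEnsemble ρ p ψ) :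
    2 * (‖ρ (low hN 0) (low hN 0).rev‖ - ∑ k ∈ Finset.univ.erase 0,
      √((ρ (low hN k) (low hN k)).re * (ρ (low hN k).rev (low hN k).rev).re)) ≤ CGM ρ := by
  obtain ⟨m₀, p₀, ψ₀, h₀⟩ := hρ
  refine le_csInf ⟨_, m₀, p₀, ψ₀, h₀, rfl⟩ ?_
  rintro _ ⟨m, p, ψ, ⟨hp, -, hψ, rfl⟩, rfl⟩
  have h1 : ∑ l, p l * (2 * (‖ψ l (low hN 0)‖ * ‖ψ l (low hN 0).rev‖ -
      ∑ k ∈ Finset.univ.erase 0, ‖ψ l (low hN k)‖ * ‖ψ l (low hN k).rev‖)) ≤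
      ∑ l, p l * pureCGM (ψ l) :=
    Finset.sum_le_sum fun l _ =>
      mul_le_mul_of_nonneg_left (pair_bound_le_pureCGM hN (ψ l) (hψ l)) (hp l)
  have h2 : ‖(∑ l, (p l : ℂ) • ketbra (ψ l)) (low hN 0) (low hN 0).rev‖ ≤
      ∑ l, p l * (‖ψ l (low hN 0)‖ * ‖ψ l (low hN 0).rev‖) := by
    rw [ensemble_apply]
    refine (norm_sum_le _ _).trans (Finset.sum_le_sum fun l _ => ?_)
    rw [norm_mul, norm_mul, norm_star, Complex.norm_real, Real.norm_of_nonneg (hp l)]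
  have hd : ∀ i, ((∑ l, (p l : ℂ) • ketbra (ψ l)) i i).re = ∑ l, p l * ‖ψ l i‖ ^ 2 := by
    intro i
    rw [ensemble_apply, Complex.re_sum]
    refine Finset.sum_congr rfl fun l _ => ?_
    rw [Complex.star_def, Complex.mul_conj, Complex.normSq_eq_norm_sq, ← Complex.ofReal_mul,
      Complex.ofReal_re]
  have h3 : ∀ k, ∑ l, p l * (‖ψ l (low hN k)‖ * ‖ψ l (low hN k).rev‖) ≤
      √(((∑ l, (p l : ℂ) • ketbra (ψ l)) (low hN k) (low hN k)).re *
        ((∑ l, (p l : ℂ) • ketbra (ψ l)) (low hN k).rev (low hN k).rev).re) := by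
    intro k
    rw [hd, hd, Real.sqrt_mul (Finset.sum_nonneg fun l _ => mul_nonneg (hp l) (sq_nonneg _))]
    have hcs := Real.sum_mul_le_sqrt_mul_sqrt Finset.univ
      (fun l => √(p l) * ‖ψ l (low hN k)‖) (fun l => √(p l) * ‖ψ l (low hN k).rev‖)
    simp only [mul_pow, Real.sq_sqrt (hp _)] at hcs
    refine le_trans (le_of_eq (Finset.sum_congr rfl fun l _ => ?_)) hcs
    linear_combination (-(‖ψ l (low hN k)‖ * ‖ψ l (low hN k).rev‖)) * Real.mul_self_sqrt (hp l)
  have h4 := Finset.sum_le_sum fun k (_ : k ∈ Finset.univ.erase (0 : Fin (2 ^ (N - 1)))) => h3 k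
  rw [Finset.sum_comm] at h4
  refine le_trans ?_ h1
  have h5 : ∑ l, p l * (2 * (‖ψ l (low hN 0)‖ * ‖ψ l (low hN 0).rev‖ -
      ∑ k ∈ Finset.univ.erase 0, ‖ψ l (low hN k)‖ * ‖ψ l (low hN k).rev‖)) =
      2 * (∑ l, p l * (‖ψ l (low hN 0)‖ * ‖ψ l (low hN 0).rev‖) -
        ∑ l, ∑ k ∈ Finset.univ.erase 0, p l * (‖ψ l (low hN k)‖ * ‖ψ l (low hN k).rev‖)) := by
    rw [← Finset.sum_sub_distrib, Finset.mul_sum]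
    refine Finset.sum_congr rfl fun l _ => ?_
    rw [← Finset.mul_sum]
    ring
  rw [h5]
  linarith

theorem CGM_nonneg {N : ℕ} (ρ : QMat N) : 0 ≤ CGM ρ := by
  apply Real.sInf_nonneg
  rintro _ ⟨m, p, ψ, h, rfl⟩
  exact Finset.sum_nonneg fun i _ => mul_nonneg (h.1 i) (pureCGM_nonneg _)

/-! ### Sums of weighted pure states -/

/-- `ρ` is a nonnegative combination of pure states of average GM-concurrence at most `κ`. -/
def Decomposes {N : ℕ} (ρ : QMat N) (κ : ℝ) : Prop :=
  ∃ (m : ℕ) (p : Fin m → ℝ) (ψ : Fin m → Fin (2 ^ N) → ℂ),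
    (∀ i, 0 ≤ p i) ∧ (∀ i, ∑ j, ‖ψ i j‖ ^ 2 = 1) ∧ ρ = ∑ i, (p i : ℂ) • ketbra (ψ i) ∧
      ∑ i, p i * pureCGM (ψ i) ≤ κ

/-- The weights are not required to sum to 1, so decomposable matrices form a convex cone on which
costs add. Normalization is restored at the end from the trace. -/
theorem Decomposes.add {N : ℕ} {ρ σ : QMat N} {κ μ : ℝ} (h : Decomposes ρ κ)
    (h' : Decomposes σ μ) : Decomposes (ρ + σ) (κ + μ) := by
  obtain ⟨m, p, ψ, hp, hψ, rfl, hκ⟩ := h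
  obtain ⟨m', p', ψ', hp', hψ', rfl, hμ⟩ := h'
  refine ⟨m + m', Fin.append p p', Fin.append ψ ψ', ?_, ?_, ?_, ?_⟩
  · intro i
    refine Fin.addCases (fun i => ?_) (fun i => ?_) i
    · rw [Fin.append_left]; exact hp i
    · rw [Fin.append_right]; exact hp' i
  · intro i
    refine Fin.addCases (fun i => ?_) (fun i => ?_) i
    · rw [Fin.append_left]; exact hψ i
    · rw [Fin.append_right]; exact hψ' i
  · simp only [Fin.sum_univ_add, Fin.append_left, Fin.append_right]
  · simp only [Fin.sum_univ_add, Fin.append_left, Fin.append_right]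
    exact add_le_add hκ hμ

theorem Decomposes.smul {N : ℕ} {ρ : QMat N} {κ : ℝ} (h : Decomposes ρ κ) {c : ℝ} (hc : 0 ≤ c) :
    Decomposes ((c : ℂ) • ρ) (c * κ) := by
  obtain ⟨m, p, ψ, hp, hψ, rfl, hκ⟩ := h
  refine ⟨m, fun i => c * p i, ψ, fun i => mul_nonneg hc (hp i), hψ, ?_, ?_⟩
  · simp only [Finset.smul_sum, smul_smul, Complex.ofReal_mul]
  · simp only [mul_assoc, ← Finset.mul_sum]
    exact mul_le_mul_of_nonneg_left hκ hc

theorem Decomposes.zero {N : ℕ} : Decomposes (0 : QMat N) 0 :=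
  ⟨0, Fin.elim0, Fin.elim0, fun i => i.elim0, fun i => i.elim0, by simp, by simp⟩

theorem Decomposes.sum {N : ℕ} {ι : Type*} (s : Finset ι) {f : ι → QMat N}
    (h : ∀ i ∈ s, Decomposes (f i) 0) : Decomposes (∑ i ∈ s, f i) 0 := by
  refine Finset.sum_induction _ (fun ρ => Decomposes ρ 0) (fun _ _ h h' => ?_)
    Decomposes.zero h
  simpa using h.add h'

theorem trace_ketbra {N : ℕ} (ψ : Fin (2 ^ N) → ℂ) :
    (ketbra ψ).trace = ((∑ j, ‖ψ j‖ ^ 2 : ℝ) : ℂ) := by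
  rw [ketbra, Matrix.trace_vecMulVec, dotProduct_comm, sum_norm_sq_eq]

theorem Decomposes.exists_isEnsemble {N : ℕ} {ρ : QMat N} {κ : ℝ} (h : Decomposes ρ κ)
    (htr : ρ.trace = 1) : ∃ (m : ℕ) (p : Fin m → ℝ) (ψ : Fin m → Fin (2 ^ N) → ℂ),
      IsEnsemble ρ p ψ ∧ ∑ i, p i * pureCGM (ψ i) ≤ κ := by
  obtain ⟨m, p, ψ, hp, hψ, rfl, hκ⟩ := h
  refine ⟨m, p, ψ, ⟨hp, ?_, hψ, rfl⟩, hκ⟩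
  simp only [Matrix.trace_sum, Matrix.trace_smul, trace_ketbra, hψ, Complex.ofReal_one,
    smul_eq_mul, mul_one] at htr
  exact_mod_cast htr

theorem Decomposes.CGM_le {N : ℕ} {ρ : QMat N} {κ : ℝ} (h : Decomposes ρ κ)
    (htr : ρ.trace = 1) : CGM ρ ≤ κ := by
  obtain ⟨m, p, ψ, he, hκ⟩ := h.exists_isEnsemble htr
  refine le_trans (csInf_le ?_ ⟨m, p, ψ, he, rfl⟩) hκ
  refine ⟨0, ?_⟩
  rintro _ ⟨m, p, ψ, h, rfl⟩
  exact Finset.sum_nonneg fun i _ => mul_nonneg (h.1 i) (pureCGM_nonneg _)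

theorem ketbra_smul {N : ℕ} (c : ℂ) (ψ : Fin (2 ^ N) → ℂ) :
    ketbra (c • ψ) = ((‖c‖ ^ 2 : ℝ) : ℂ) • ketbra ψ := by
  ext i j
  simp only [ketbra, Matrix.vecMulVec_apply, Matrix.smul_apply, Pi.smul_apply, Pi.star_apply,
    smul_eq_mul, star_mul']
  rw [← Complex.normSq_eq_norm_sq, ← Complex.mul_conj, Complex.star_def]
  ring

/-- One bipartition suffices for an upper bound on the minimum. The tangle has degree four, so
$\sqrt{\mathrm{tangle}}$ scales like the weight $\|\psi\|^2$ and unnormalized vectors can be used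
directly; the zero vector takes the empty decomposition. -/
theorem decomposes_ketbra {N : ℕ} (A : Bipartition N) (ψ : Fin (2 ^ N) → ℂ) {κ : ℝ} (hκ : 0 ≤ κ)
    (h : tangle (amp A.1 ψ) ≤ κ ^ 2) : Decomposes (ketbra ψ) κ := by
  have hq : 0 ≤ ∑ j, ‖ψ j‖ ^ 2 := by positivity
  rcases hq.eq_or_lt with h0 | hpos
  · have hψ : ψ = 0 := by
      funext j
      have := (Finset.sum_eq_zero_iff_of_nonneg fun j _ => sq_nonneg ‖ψ j‖).1 h0.symm j
        (Finset.mem_univ j)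
      simpa using this
    have hz : ketbra ψ = 0 := by rw [hψ, ketbra, Matrix.zero_vecMulVec]
    obtain ⟨m, p, χ, h1, h2, h3, h4⟩ := Decomposes.zero (N := N)
    exact ⟨m, p, χ, h1, h2, hz.trans h3, h4.trans hκ⟩
  · set q := ∑ j, ‖ψ j‖ ^ 2 with hqdef
    have hc : ‖((√q)⁻¹ : ℂ)‖ ^ 2 = q⁻¹ := by
      rw [norm_inv, Complex.norm_real, inv_pow, Real.norm_of_nonneg (Real.sqrt_nonneg _),
        Real.sq_sqrt hq]
    have hu : ∑ j, ‖(((√q)⁻¹ : ℂ) • ψ) j‖ ^ 2 = 1 := by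
      simp only [Pi.smul_apply, smul_eq_mul, norm_mul, mul_pow, hc, ← Finset.mul_sum, ← hqdef]
      exact inv_mul_cancel₀ hpos.ne'
    refine ⟨1, fun _ => q, fun _ => ((√q)⁻¹ : ℂ) • ψ, fun _ => hq, fun _ => hu, ?_, ?_⟩
    · rw [Fin.sum_univ_one, ketbra_smul, hc, smul_smul, ← Complex.ofReal_mul,
        mul_inv_cancel₀ hpos.ne', Complex.ofReal_one, one_smul]
    · rw [Fin.sum_univ_one]
      have h1 := pureCGM_le A _ hu
      rw [amp_smul, tangle_smul, hc, Real.sqrt_mul (sq_nonneg _),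
        Real.sqrt_sq (inv_nonneg.2 hq)] at h1
      have h2 : √(tangle (amp A.1 ψ)) ≤ κ := Real.sqrt_le_iff.2 ⟨hκ, h⟩
      calc q * pureCGM (((√q)⁻¹ : ℂ) • ψ) ≤ q * (q⁻¹ * √(tangle (amp A.1 ψ))) :=
            mul_le_mul_of_nonneg_left h1 hq
        _ = √(tangle (amp A.1 ψ)) := by rw [← mul_assoc, mul_inv_cancel₀ hpos.ne', one_mul]
        _ ≤ κ := h2

/-! ### Blocks on pairs of complementary bit strings -/

/-- The matrix with the block `[[a, z], [z̄, b]]` on the basis vectors `i` and `i.rev`. -/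
def pairBlock {N : ℕ} (i : Fin (2 ^ N)) (a b z : ℂ) : QMat N :=
  Matrix.single i i a + Matrix.single i i.rev z + Matrix.single i.rev i (star z) +
    Matrix.single i.rev i.rev b

/-- The vector `x |i⟩ + y |i.rev⟩`. -/
def pairVec {N : ℕ} (i : Fin (2 ^ N)) (x y : ℂ) : Fin (2 ^ N) → ℂ :=
  Pi.single i x + Pi.single i.rev y

theorem vecMulVec_single_single {m n : Type*} [DecidableEq m] [DecidableEq n] (i : m) (j : n)
    (x y : ℂ) :
    Matrix.vecMulVec (Pi.single i x) (Pi.single j y) = Matrix.single i j (x * y) := by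
  ext k l
  rw [Matrix.vecMulVec_apply, Pi.single_apply, Pi.single_apply, Matrix.single_apply]
  by_cases h : i = k <;> by_cases h' : j = l <;> simp [h, h', Ne.symm]

theorem vecMulVec_single_star {N : ℕ} (i j : Fin (2 ^ N)) (x y : ℂ) :
    Matrix.vecMulVec (Pi.single i x) (star (Pi.single j y : Fin (2 ^ N) → ℂ)) =
      Matrix.single i j (x * star y) := by
  rw [← Pi.single_star, vecMulVec_single_single]

theorem ketbra_pairVec {N : ℕ} (i : Fin (2 ^ N)) (x y : ℂ) :
    ketbra (pairVec i x y) = pairBlock i (x * star x) (y * star y) (x * star y) := by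
  rw [ketbra, pairVec, star_add, Matrix.add_vecMulVec, Matrix.vecMulVec_add, Matrix.vecMulVec_add]
  simp only [vecMulVec_single_star, pairBlock, star_mul, star_star]
  abel

theorem pairBlock_add {N : ℕ} (i : Fin (2 ^ N)) (a b z a' b' z' : ℂ) :
    pairBlock i a b z + pairBlock i a' b' z' = pairBlock i (a + a') (b + b') (z + z') := by
  simp only [pairBlock, Matrix.single_add, star_add]
  abel

theorem smul_pairBlock {N : ℕ} (i : Fin (2 ^ N)) (c : ℝ) (a b z : ℂ) :
    (c : ℂ) • pairBlock i a b z = pairBlock i (c * a) (c * b) (c * z) := by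
  simp only [pairBlock, smul_add, Matrix.smul_single, smul_eq_mul, star_mul', Complex.star_def,
    Complex.conj_ofReal]

theorem ketbra_add_ketbra_sub {N : ℕ} (v w : Fin (2 ^ N) → ℂ) :
    ketbra v + ketbra w = ((1 / 2 : ℝ) : ℂ) • ketbra (v + w) +
      ((1 / 2 : ℝ) : ℂ) • ketbra (v - w) := by
  ext i j
  simp only [ketbra, Matrix.vecMulVec_apply, Matrix.smul_apply, Matrix.add_apply, Pi.add_apply,
    Pi.sub_apply, Pi.star_apply, star_add, star_sub, smul_eq_mul]
  push_cast
  ring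

theorem xMatrix_eq_sum {N : ℕ} (hN : 2 ≤ N) (a b r φ : ℕ → ℝ) :
    xMatrix hN a b r φ = ∑ k : Fin (2 ^ (N - 1)), pairBlock (low hN k) (a ((k : ℕ) + 1))
      (b ((k : ℕ) + 1)) (antiEntry r φ ((k : ℕ) + 1)) := by
  rw [xMatrix_eq_reindex]
  ext i j
  obtain ⟨x, rfl⟩ := (pairEquiv hN).surjective i
  obtain ⟨y, rfl⟩ := (pairEquiv hN).surjective j
  have hne : ∀ j k, (low hN j).rev ≠ low hN k := fun j k => (low_ne_rev_low hN k j).symm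
  rw [Matrix.sum_apply]
  rcases x with x | x <;> rcases y with y | y <;>
    rw [Matrix.reindex_apply, Matrix.submatrix_apply, Equiv.symm_apply_apply,
      Equiv.symm_apply_apply] <;>
    simp only [pairEquiv_inl, pairEquiv_inr, pairBlock, Matrix.add_apply, Matrix.single_apply,
      (low_injective hN).eq_iff, Fin.rev_inj, low_ne_rev_low, hne, false_and, and_false, if_false,
      add_zero, zero_add] <;>
    by_cases h : x = y <;>
    simp [h, ite_and]

/-! ### Pure states supported on two complementary pairs -/

/-- The condition $xy=x'y'$ is the vanishing of the $2\times2$ determinant, so the amplitude matrix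
factors as a column times a row; $x\ne0$ permits the explicit factorization. -/
theorem tangle_two_by_two {m n : Type*} [Fintype m] [Fintype n] [DecidableEq m] [DecidableEq n]
    (s s' : m) (t t' : n) {x y x' y' : ℂ} (hx : x ≠ 0) (h : x * y = x' * y') :
    tangle (Matrix.single s t x + Matrix.single s' t' y +
      (Matrix.single s t' x' + Matrix.single s' t y')) = 0 := by
  have e : Matrix.single s t x + Matrix.single s' t' y +
      (Matrix.single s t' x' + Matrix.single s' t y') =
      Matrix.vecMulVec (Pi.single s x + Pi.single s' y')
        (Pi.single t 1 + Pi.single t' (x' / x)) := by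
    have hy : y = y' * (x' / x) := by
      field_simp
      linear_combination h
    have hx' : x * (x' / x) = x' := by field_simp
    simp only [Matrix.add_vecMulVec, Matrix.vecMulVec_add, vecMulVec_single_single, mul_one,
      hx', ← hy]
    abel
  rw [e, tangle_vecMulVec]

/-- Two basis states that are neither equal nor complementary differ exactly off some
bipartition. -/
theorem exists_bipartition {N : ℕ} {i j : Fin (2 ^ N)} (h : i ≠ j) (h' : i ≠ j.rev) :
    ∃ (A : Bipartition N) (s : {k // k ∈ A.1} → Fin 2) (t : {k // k ∉ A.1} → Fin 2),
      i = glue A.1 s t ∧ i.rev = glue A.1 (fun k => (s k).rev) (fun k => (t k).rev) ∧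
      j = glue A.1 s (fun k => (t k).rev) ∧ j.rev = glue A.1 (fun k => (s k).rev) t := by
  have hrev : ∀ x y : Fin 2, x ≠ y → y = x.rev := by decide
  let A : Finset (Fin N) := Finset.univ.filter fun k => bits N i k = bits N j k
  have hA : A.Nonempty := by
    by_contra hA
    rw [Finset.not_nonempty_iff_eq_empty, Finset.filter_eq_empty_iff] at hA
    apply h'
    apply (bits N).injective
    funext k
    rw [bits_rev]
    exact hrev _ _ fun he => hA (Finset.mem_univ k) he.symm
  have hA' : Aᶜ.Nonempty := by
    by_contra hA
    rw [Finset.not_nonempty_iff_eq_empty, Finset.compl_eq_empty_iff] at hA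
    refine h ((bits N).injective (funext fun k => ?_))
    have hk : k ∈ A := hA ▸ Finset.mem_univ k
    exact (Finset.mem_filter.1 hk).2
  have hi : i = glue A (fun k => bits N i k) (fun k => bits N i k) := by
    apply (bits N).injective
    funext k
    rw [bits_glue]
    split_ifs <;> rfl
  have hj : j = glue A (fun k => bits N i k) (fun k => (bits N i k).rev) := by
    apply (bits N).injective
    funext k
    rw [bits_glue]
    split_ifs with hk
    · exact (Finset.mem_filter.1 hk).2.symm
    · exact hrev _ _ fun he => hk (Finset.mem_filter.2 ⟨Finset.mem_univ k, he⟩)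
  refine ⟨⟨A, hA, hA'⟩, _, _, hi, ?_, hj, ?_⟩
  · rw [glue_rev, ← hi]
  · have := glue_rev A (fun k => bits N i k) (fun k => (bits N i k).rev)
    rw [← hj] at this
    rw [← this]
    simp

theorem decomposes_ketbra_add {N : ℕ} {i j : Fin (2 ^ N)} (h : i ≠ j) (h' : i ≠ j.rev)
    {x y x' y' : ℂ} (hx : x ≠ 0) (hxy : x * y = x' * y') :
    Decomposes (ketbra (pairVec i x y + pairVec j x' y')) 0 := by
  obtain ⟨A, s, t, hi, hi', hj, hj'⟩ := exists_bipartition h h'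
  refine decomposes_ketbra A _ le_rfl (le_of_eq ?_)
  rw [amp_add, pairVec, pairVec, amp_add, amp_add, hi', hj', hi, hj]
  simp only [amp_single]
  rw [tangle_two_by_two _ _ _ _ hx hxy]
  simp

theorem decomposes_ketbra_pairVec {N : ℕ} (hN : 2 ≤ N) (i : Fin (2 ^ N)) (x y : ℂ) :
    Decomposes (ketbra (pairVec i x y)) (2 * (‖x‖ * ‖y‖)) := by
  obtain ⟨A⟩ := nonempty_bipartition hN
  refine decomposes_ketbra A _ (by positivity) (le_of_eq ?_)
  obtain ⟨⟨s, t⟩, hst⟩ := (glueEquiv A.1).surjective i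
  rw [glueEquiv_apply] at hst
  have hrev : ∀ x : Fin 2, x ≠ x.rev := by decide
  obtain ⟨k, hk⟩ := A.2.1
  obtain ⟨l, hl⟩ := A.2.2
  rw [Finset.mem_compl] at hl
  rw [pairVec, ← hst, ← glue_rev, amp_add, amp_single, amp_single]
  exact tangle_single_add_single (fun h => hrev _ (congrFun h ⟨k, hk⟩))
    (fun h => hrev _ (congrFun h ⟨l, hl⟩)) x y

/-! ### Decomposing an X-matrix -/

/-- The block `[[s, ζ], [ζ̄, 1/s]]` on the basis vectors `i` and `i.rev`. -/
def unitBlock {N : ℕ} (i : Fin (2 ^ N)) (s : ℝ) (ζ : ℂ) : QMat N :=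
  pairBlock i (s : ℂ) ((s⁻¹ : ℝ) : ℂ) ζ

/-- For $|u|=1$ the block has determinant zero, hence rank one. The irrelevant global phase $\chi$
is kept free, to be tuned when two blocks are superposed. -/
theorem unitBlock_eq_ketbra {N : ℕ} (i : Fin (2 ^ N)) {s : ℝ} (hs : 0 < s) {u χ : ℂ}
    (hu : ‖u‖ = 1) (hχ : ‖χ‖ = 1) :
    unitBlock i s u = ketbra (pairVec i (χ * √s) (χ * (star u * ((√s)⁻¹ : ℝ)))) := by
  have hss : (√s : ℂ) * √s = s := by
    rw [← Complex.ofReal_mul, Real.mul_self_sqrt hs.le]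
  have hs0 : (√s : ℂ) ≠ 0 := by
    exact_mod_cast (Real.sqrt_pos.2 hs).ne'
  have huu : u * star u = 1 := by
    rw [Complex.star_def, Complex.mul_conj, Complex.normSq_eq_norm_sq, hu]; simp
  have hχχ : χ * star χ = 1 := by
    rw [Complex.star_def, Complex.mul_conj, Complex.normSq_eq_norm_sq, hχ]; simp
  rw [ketbra_pairVec, unitBlock]
  simp only [star_mul', Complex.conj_conj, Complex.ofReal_inv, Complex.star_def,
    Complex.conj_ofReal, map_inv₀] at *
  rw [← hss]
  congr 1
  · linear_combination (-(√s : ℂ) * √s) * hχχ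
  · field_simp
    linear_combination (-(χ * starRingEnd ℂ χ)) * huu - hχχ
  · field_simp
    linear_combination (-u) * hχχ

theorem decomposes_unitBlock_of_norm_eq_one {N : ℕ} (hN : 2 ≤ N) (i : Fin (2 ^ N)) {s : ℝ}
    (hs : 0 < s) {u : ℂ} (hu : ‖u‖ = 1) : Decomposes (unitBlock i s u) 2 := by
  have h := decomposes_ketbra_pairVec hN i (1 * √s) (1 * (star u * ((√s)⁻¹ : ℝ)))
  rw [← unitBlock_eq_ketbra i hs hu norm_one] at h
  have hs0 := (Real.sqrt_pos.2 hs)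
  have e : 2 * (‖(1 * √s : ℂ)‖ * ‖(1 * (star u * ((√s)⁻¹ : ℝ)) : ℂ)‖) = 2 := by
    rw [one_mul, one_mul, norm_mul, norm_star, hu, Complex.norm_real, Complex.norm_real,
      Real.norm_of_nonneg hs0.le, Real.norm_of_nonneg (inv_nonneg.2 hs0.le), one_mul,
      mul_inv_cancel₀ hs0.ne', mul_one]
  rwa [e] at h

/-- The blocks are $|v\rangle\langle v|$ and $|w\rangle\langle w|$, and their sum is the equal
mixture of $v\pm w$. The two amplitudes of $v$ have product $\bar u$, those of $w$ have product
$\chi^2\bar u'$. Choosing $\chi^2=\bar u u'$ makes them equal for both signs of $\chi$, so both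
superpositions are product vectors across a common bipartition. -/
theorem decomposes_unitBlock_add_of_norm_eq_one {N : ℕ} {i j : Fin (2 ^ N)} (h : i ≠ j)
    (h' : i ≠ j.rev) {s s' : ℝ} (hs : 0 < s) (hs' : 0 < s') {u u' : ℂ} (hu : ‖u‖ = 1)
    (hu' : ‖u'‖ = 1) : Decomposes (unitBlock i s u + unitBlock j s' u') 0 := by
  obtain ⟨χ, hχ⟩ := IsAlgClosed.exists_eq_mul_self (star u * u')
  have hχ1 : ‖χ‖ = 1 := by
    have := congrArg norm hχ
    rw [norm_mul, norm_mul, norm_star, hu, hu'] at this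
    nlinarith [norm_nonneg χ]
  have huu : u' * star u' = 1 := by
    rw [Complex.star_def, Complex.mul_conj, Complex.normSq_eq_norm_sq, hu']; simp
  have hs0 : (√s : ℂ) ≠ 0 := by exact_mod_cast (Real.sqrt_pos.2 hs).ne'
  have hs0' : (√s' : ℂ) ≠ 0 := by exact_mod_cast (Real.sqrt_pos.2 hs').ne'
  have key : ∀ χ' : ℂ, χ' * χ' = star u * u' →
      Decomposes (ketbra (pairVec i (1 * √s) (1 * (star u * ((√s)⁻¹ : ℝ))) +
        pairVec j (χ' * √s') (χ' * (star u' * ((√s')⁻¹ : ℝ))))) 0 := by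
    intro χ' hχ'
    refine decomposes_ketbra_add h h' (by rwa [one_mul]) ?_
    rw [Complex.ofReal_inv, Complex.ofReal_inv]
    field_simp
    linear_combination (-star u') * hχ' - star u * huu
  rw [unitBlock_eq_ketbra i hs hu norm_one, unitBlock_eq_ketbra j hs' hu' hχ1,
    ketbra_add_ketbra_sub]
  have e : ∀ x y : ℂ, pairVec j ((-χ) * x) ((-χ) * y) = -pairVec j (χ * x) (χ * y) := by
    intro x y
    rw [pairVec, pairVec, neg_mul, neg_mul, Pi.single_neg, Pi.single_neg, neg_add]
  have h1 := (key χ hχ.symm).smul (c := 1 / 2) (by norm_num)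
  have h2 := (key (-χ) (by rw [neg_mul_neg, hχ])).smul (c := 1 / 2) (by norm_num)
  rw [e, ← sub_eq_add_neg] at h2
  simpa using h1.add h2

/-- It suffices to decompose blocks whose off-diagonal entry has modulus one. -/
theorem decomposes_unitBlock_convex {N : ℕ} (i : Fin (2 ^ N)) (s : ℝ) (R : QMat N) (κ : ℝ)
    (h : ∀ u : ℂ, ‖u‖ = 1 → Decomposes (unitBlock i s u + R) κ) {ζ : ℂ} (hζ : ‖ζ‖ ≤ 1) :
    Decomposes (unitBlock i s ζ + R) κ := by
  obtain ⟨u, hu, hu'⟩ : ∃ u : ℂ, ‖u‖ = 1 ∧ ζ = ‖ζ‖ * u := by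
    by_cases h0 : ζ = 0
    · exact ⟨1, norm_one, by simp [h0]⟩
    · refine ⟨ζ / ‖ζ‖, ?_, ?_⟩
      · rw [norm_div, Complex.norm_real, norm_norm, div_self (norm_ne_zero_iff.2 h0)]
      · rw [mul_div_cancel₀]
        exact_mod_cast norm_ne_zero_iff.2 h0
  -- The weights $(1\pm|\zeta|)/2$ locate $\zeta$ on the diameter from $-u$ to $u$.
  have h1 := (h u hu).smul (c := (1 + ‖ζ‖) / 2) (by positivity)
  have h2 := (h (-u) (by rwa [norm_neg])).smul (c := (1 - ‖ζ‖) / 2) (by linarith)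
  have h3 := h1.add h2
  have e1 : (1 + ‖ζ‖) / 2 * κ + (1 - ‖ζ‖) / 2 * κ = κ := by ring
  have e2 : ((((1 + ‖ζ‖) / 2 : ℝ) : ℂ) • (unitBlock i s u + R) +
      (((1 - ‖ζ‖) / 2 : ℝ) : ℂ) • (unitBlock i s (-u) + R)) = unitBlock i s ζ + R := by
    have eR : (((1 + ‖ζ‖) / 2 : ℝ) : ℂ) • R + (((1 - ‖ζ‖) / 2 : ℝ) : ℂ) • R = R := by
      rw [← add_smul, ← Complex.ofReal_add]
      have : (1 + ‖ζ‖) / 2 + (1 - ‖ζ‖) / 2 = 1 := by ring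
      rw [this, Complex.ofReal_one, one_smul]
    have eB : (((1 + ‖ζ‖) / 2 : ℝ) : ℂ) • unitBlock i s u +
        (((1 - ‖ζ‖) / 2 : ℝ) : ℂ) • unitBlock i s (-u) = unitBlock i s ζ := by
      rw [unitBlock, unitBlock, unitBlock, smul_pairBlock, smul_pairBlock, pairBlock_add]
      congr 1
      · push_cast; ring
      · push_cast; ring
      · rw [hu']
        simp only [norm_mul, Complex.norm_real, norm_norm, hu, mul_one]
        push_cast; ring
    rw [smul_add, smul_add, add_add_add_comm, eB, eR]
  rwa [e1, e2] at h3

theorem decomposes_unitBlock {N : ℕ} (hN : 2 ≤ N) (i : Fin (2 ^ N)) {s : ℝ} (hs : 0 < s) {ζ : ℂ}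
    (hζ : ‖ζ‖ ≤ 1) : Decomposes (unitBlock i s ζ) 2 := by
  rw [← add_zero (unitBlock i s ζ)]
  refine decomposes_unitBlock_convex i s 0 2 (fun u hu => ?_) hζ
  rw [add_zero]
  exact decomposes_unitBlock_of_norm_eq_one hN i hs hu

theorem decomposes_unitBlock_add {N : ℕ} {i j : Fin (2 ^ N)} (h : i ≠ j)
    (h' : i ≠ j.rev) {s s' : ℝ} (hs : 0 < s) (hs' : 0 < s') {ζ ζ' : ℂ} (hζ : ‖ζ‖ ≤ 1)
    (hζ' : ‖ζ'‖ ≤ 1) : Decomposes (unitBlock i s ζ + unitBlock j s' ζ') 0 := by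
  refine decomposes_unitBlock_convex i s _ 0 (fun u hu => ?_) hζ
  rw [add_comm]
  refine decomposes_unitBlock_convex j s' _ 0 (fun u' hu' => ?_) hζ'
  rw [add_comm]
  exact decomposes_unitBlock_add_of_norm_eq_one h h' hs hs' hu hu'

theorem decomposes_diagonal {N : ℕ} (hN : 2 ≤ N) (i : Fin (2 ^ N)) {a b : ℝ} (ha : 0 ≤ a)
    (hb : 0 ≤ b) : Decomposes (pairBlock i (a : ℂ) (b : ℂ) 0) 0 := by
  have h1 := decomposes_ketbra_pairVec hN i (√a : ℂ) 0
  have h2 := decomposes_ketbra_pairVec hN i 0 (√b : ℂ)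
  have e : ∀ x : ℝ, 0 ≤ x → (√x : ℂ) * star (√x : ℂ) = x := by
    intro x hx
    rw [Complex.star_def, Complex.conj_ofReal, ← Complex.ofReal_mul, Real.mul_self_sqrt hx]
  rw [ketbra_pairVec, e a ha] at h1
  rw [ketbra_pairVec, e b hb] at h2
  have h3 := h1.add h2
  rw [pairBlock_add] at h3
  simpa using h3

/-- With $s=\sqrt{a/b}$, each of $cs\le a$ and $c/s\le b$ amounts to $c\le\sqrt{ab}$, so what
remains after removing the weighted normalized block is diagonal and nonnegative. For $c=0$ the
value of $s$ is immaterial. -/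
theorem exists_block_split {a b c : ℝ} (ha : 0 ≤ a) (hb : 0 ≤ b) {z : ℂ} (hz : ‖z‖ ≤ c)
    (hc : c ≤ √(a * b)) : ∃ (s : ℝ) (ζ : ℂ) (a' b' : ℝ), 0 < s ∧ ‖ζ‖ ≤ 1 ∧ 0 ≤ a' ∧ 0 ≤ b' ∧
      a = c * s + a' ∧ b = c * s⁻¹ + b' ∧ z = c * ζ := by
  have hc0 : 0 ≤ c := (norm_nonneg z).trans hz
  rcases hc0.eq_or_lt with rfl | hpos
  · refine ⟨1, 0, a, b, one_pos, by simp, ha, hb, by simp, by simp, ?_⟩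
    simpa using hz
  · have hab : 0 < √a * √b := by
      rw [← Real.sqrt_mul ha]
      exact hpos.trans_le hc
    have ha0 : 0 < √a := by
      refine (Real.sqrt_nonneg a).lt_of_ne fun h => ?_
      rw [← h, zero_mul] at hab; exact hab.false
    have hb0 : 0 < √b := by
      refine (Real.sqrt_nonneg b).lt_of_ne fun h => ?_
      rw [← h, mul_zero] at hab; exact hab.false
    rw [Real.sqrt_mul ha] at hc
    refine ⟨√a / √b, z / c, a - c * (√a / √b), b - c * (√a / √b)⁻¹, div_pos ha0 hb0, ?_, ?_, ?_,
      by ring, by ring, ?_⟩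
    · rw [norm_div, Complex.norm_real, Real.norm_of_nonneg hc0]
      exact (div_le_one hpos).2 hz
    · have : c * (√a / √b) ≤ a := by
        rw [← mul_div_assoc, div_le_iff₀ hb0]
        nlinarith [Real.mul_self_sqrt ha]
      linarith
    · have : c * (√a / √b)⁻¹ ≤ b := by
        rw [inv_div, ← mul_div_assoc, div_le_iff₀ ha0]
        nlinarith [Real.mul_self_sqrt hb]
      linarith
    · rw [mul_div_cancel₀]
      exact_mod_cast ne_of_gt hpos

/-! ### Polygon inequalities -/

section Polygon

variable {ι : Type*} [Fintype ι] [DecidableEq ι]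

theorem eq_sum_star (c : ι → ℝ) (k : ι) (h : c k = ∑ j ∈ Finset.univ.erase k, c j) :
    c = ∑ j ∈ Finset.univ.erase k, (Pi.single j (c j) + Pi.single k (c j)) := by
  funext i
  by_cases hi : i = k
  · subst hi
    have hz : ∑ j ∈ Finset.univ.erase i, (Pi.single j (c j) : ι → ℝ) i = 0 :=
      Finset.sum_eq_zero fun j hj => Pi.single_eq_of_ne (Finset.ne_of_mem_erase hj).symm _
    simp only [Finset.sum_apply, Pi.add_apply, Finset.sum_add_distrib, Pi.single_eq_same]
    rw [hz, zero_add, h]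
  · simp only [Finset.sum_apply, Pi.add_apply, Pi.single_eq_of_ne hi, add_zero]
    rw [Finset.sum_eq_single i]
    · rw [Pi.single_eq_same]
    · exact fun j _ hj => Pi.single_eq_of_ne hj.symm _
    · exact fun h => absurd (Finset.mem_erase.2 ⟨hi, Finset.mem_univ i⟩) h

/-- The extreme case of the polygon inequalities: when one entry equals the sum of the others, it is
paired with each of them in turn. -/
theorem star_induction (S : (ι → ℝ) → Prop) (h0 : S 0) (hadd : ∀ c d, S c → S d → S (c + d))
    (hpair : ∀ i j t, i ≠ j → 0 ≤ t → S (Pi.single i t + Pi.single j t)) (c : ι → ℝ)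
    (hc : ∀ i, 0 ≤ c i) (k : ι) (h : c k = ∑ j ∈ Finset.univ.erase k, c j) : S c := by
  rw [eq_sum_star c k h]
  exact Finset.sum_induction _ S hadd h0
    fun j hj => hpair j k _ (Finset.ne_of_mem_erase hj) (hc j)

/-- A nonnegative vector satisfying the polygon inequalities is a nonnegative combination of the
vectors `e_i + e_j` with `i ≠ j`. -/
theorem polygon_induction (S : (ι → ℝ) → Prop) (h0 : S 0) (hadd : ∀ c d, S c → S d → S (c + d))
    (hpair : ∀ i j t, i ≠ j → 0 ≤ t → S (Pi.single i t + Pi.single j t)) (c : ι → ℝ)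
    (hc : ∀ i, 0 ≤ c i) (hpoly : ∀ i, c i ≤ ∑ j ∈ Finset.univ.erase i, c j) : S c := by
  induction hn : (Finset.univ.filter fun i => c i ≠ 0).card using Nat.strong_induction_on
    generalizing c with
  | _ n ih =>
  by_cases hz : c = 0
  · rw [hz]; exact h0
  obtain ⟨i, hi⟩ := Function.ne_iff.1 hz
  have hi0 : 0 < c i := (hc i).lt_of_ne (Ne.symm hi)
  obtain ⟨j, hj, hj'⟩ := Finset.exists_ne_zero_of_sum_ne_zero (hi0.trans_le (hpoly i)).ne'
  have hij : i ≠ j := (Finset.ne_of_mem_erase hj).symm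
  have hj0 : 0 < c j := (hc j).lt_of_ne (Ne.symm hj')
  have herase : ∀ (d : ι → ℝ) k, ∑ l ∈ Finset.univ.erase k, d l = ∑ l, d l - d k :=
    fun _ k => Finset.sum_erase_eq_sub (Finset.mem_univ k)
  have hci : ∀ t, (c - (Pi.single i t + Pi.single j t) : ι → ℝ) i = c i - t := by
    intro t; simp [hij]
  have hcj : ∀ t, (c - (Pi.single i t + Pi.single j t) : ι → ℝ) j = c j - t := by
    intro t; simp [hij.symm]
  have hck : ∀ t k, k ≠ i → k ≠ j → (c - (Pi.single i t + Pi.single j t) : ι → ℝ) k = c k := by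
    intro t k hki hkj; simp [hki, hkj]
  have hct : ∀ t, ∑ k, (c - (Pi.single i t + Pi.single j t) : ι → ℝ) k = ∑ k, c k - 2 * t := by
    intro t
    simp only [Pi.sub_apply, Pi.add_apply, Finset.sum_sub_distrib, Finset.sum_add_distrib,
      Finset.sum_pi_single', Finset.mem_univ, if_true]
    ring
  have hnn : ∀ t, t ≤ c i → t ≤ c j → ∀ k, 0 ≤ (c - (Pi.single i t + Pi.single j t) : ι → ℝ) k := by
    intro t hti htj k
    by_cases hki : k = i
    · rw [hki, hci]; linarith
    by_cases hkj : k = j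
    · rw [hkj, hcj]; linarith
    rw [hck t k hki hkj]; exact hc k
  have hback : ∀ t, 0 ≤ t → S (c - (Pi.single i t + Pi.single j t)) → S c := by
    intro t ht h
    have := hadd _ _ h (hpair i j t hij ht)
    rwa [sub_add_cancel] at this
  simp only [herase] at hpoly ih
  -- Subtracting $t(e_i+e_j)$ can only violate the inequality at a third index. If $t=\min(c_i,c_j)$
  -- is admissible, the support shrinks and induction applies.
  by_cases hk : ∀ k, k ≠ i → k ≠ j → 2 * c k ≤ ∑ l, c l - 2 * min (c i) (c j)
  · have ht0 : 0 ≤ min (c i) (c j) := le_min hi0.le hj0.le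
    have hti := min_le_left (c i) (c j)
    have htj := min_le_right (c i) (c j)
    refine hback _ ht0 (ih _ ?_ _ (hnn _ hti htj) ?_ rfl)
    · rw [← hn]
      apply Finset.card_lt_card
      refine Finset.ssubset_iff_subset_ne.2 ⟨fun k hk => ?_, fun he => ?_⟩
      · rw [Finset.mem_filter] at hk ⊢
        refine ⟨hk.1, fun h => hk.2 ?_⟩
        have hki : k ≠ i := by rintro rfl; exact hi0.ne' h
        have hkj : k ≠ j := by rintro rfl; exact hj0.ne' h
        rw [hck _ k hki hkj, h]
      · rcases min_choice (c i) (c j) with h | h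
        · have hm : i ∈ Finset.univ.filter fun k => c k ≠ 0 := by simpa using hi0.ne'
          rw [← he, Finset.mem_filter, hci, h] at hm
          exact hm.2 (sub_self _)
        · have hm : j ∈ Finset.univ.filter fun k => c k ≠ 0 := by simpa using hj0.ne'
          rw [← he, Finset.mem_filter, hcj, h] at hm
          exact hm.2 (sub_self _)
    · intro k
      rw [hct]
      by_cases hki : k = i
      · have := hpoly i
        rw [hki, hci]; linarith
      by_cases hkj : k = j
      · have := hpoly j
        rw [hkj, hcj]; linarith
      have := hk k hki hkj
      rw [hck _ k hki hkj]; linarith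
  · push Not at hk
    obtain ⟨k, hki, hkj, hlt⟩ := hk
    have hpk := hpoly k
    have hti := min_le_left (c i) (c j)
    have htj := min_le_right (c i) (c j)
    -- This $t$ turns the inequality at $k$ into an equality, so the remainder is a star centred at
    -- $k$.
    refine hback ((∑ l, c l - 2 * c k) / 2) (by linarith)
      (star_induction S h0 hadd hpair _ (hnn _ (by linarith) (by linarith)) k ?_)
    rw [herase, hct, hck _ k hki hkj]
    ring

end Polygon

/-! ### The upper bound for X-matrices -/

/-- If an off-diagonal entry dominates the diagonal weights of the other blocks, the X-matrix
decomposes with the expected excess; otherwise it is biseparable. -/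
theorem decomposes_xMatrix {N : ℕ} (hN : 2 ≤ N) (a b : Fin (2 ^ (N - 1)) → ℝ)
    (z : Fin (2 ^ (N - 1)) → ℂ) (ha : ∀ k, 0 ≤ a k) (hb : ∀ k, 0 ≤ b k)
    (hz : ∀ k, ‖z k‖ ≤ √(a k * b k)) :
    (∃ i, Decomposes (∑ k, pairBlock (low hN k) (a k) (b k) (z k))
      (2 * (‖z i‖ - ∑ k ∈ Finset.univ.erase i, √(a k * b k)))) ∨
    Decomposes (∑ k, pairBlock (low hN k) (a k) (b k) (z k)) 0 := by
  have hm : ∀ k, 0 ≤ √(a k * b k) := fun k => Real.sqrt_nonneg _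
  -- The weights may be chosen anywhere between $|z_k|$ and $\sqrt{a_kb_k}$; diagonal remainders
  -- cost nothing.
  have reduce : ∀ (c : Fin (2 ^ (N - 1)) → ℝ) (κ : ℝ), (∀ k, ‖z k‖ ≤ c k) →
      (∀ k, c k ≤ √(a k * b k)) →
      (∀ (s : Fin (2 ^ (N - 1)) → ℝ) (ζ : Fin (2 ^ (N - 1)) → ℂ), (∀ k, 0 < s k) →
        (∀ k, ‖ζ k‖ ≤ 1) → Decomposes (∑ k, (c k : ℂ) • unitBlock (low hN k) (s k) (ζ k)) κ) →
      Decomposes (∑ k, pairBlock (low hN k) (a k) (b k) (z k)) κ := by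
    intro c κ h1 h2 h
    choose s ζ a' b' hs hζ ha' hb' hea heb hez using
      fun k => exists_block_split (ha k) (hb k) (h1 k) (h2 k)
    have e : ∑ k, pairBlock (low hN k) (a k) (b k) (z k) =
        ∑ k, (c k : ℂ) • unitBlock (low hN k) (s k) (ζ k) +
        ∑ k, pairBlock (low hN k) (a' k : ℂ) (b' k : ℂ) 0 := by
      rw [← Finset.sum_add_distrib]
      refine Finset.sum_congr rfl fun k _ => ?_
      rw [unitBlock, smul_pairBlock, pairBlock_add, ← hez, ← Complex.ofReal_mul,
        ← Complex.ofReal_mul, ← Complex.ofReal_add, ← Complex.ofReal_add, ← hea, ← heb, add_zero]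
    rw [e, ← add_zero κ]
    exact (h s ζ hs hζ).add (Decomposes.sum _ fun k _ => decomposes_diagonal hN _ (ha' k) (hb' k))
  have hS0 : ∀ T : Fin (2 ^ (N - 1)) → QMat N,
      Decomposes (∑ k, (((0 : Fin (2 ^ (N - 1)) → ℝ) k : ℝ) : ℂ) • T k) 0 := by
    intro T
    simpa using Decomposes.zero
  have hSadd : ∀ (T : Fin (2 ^ (N - 1)) → QMat N) (c d : Fin (2 ^ (N - 1)) → ℝ) (κ μ : ℝ),
      Decomposes (∑ k, (c k : ℂ) • T k) κ → Decomposes (∑ k, (d k : ℂ) • T k) μ →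
      Decomposes (∑ k, (((c + d) k : ℝ) : ℂ) • T k) (κ + μ) := by
    intro T c d κ μ h h'
    simp only [Pi.add_apply, Complex.ofReal_add, add_smul, Finset.sum_add_distrib]
    exact h.add h'
  have hsingle : ∀ (T : Fin (2 ^ (N - 1)) → QMat N) i (t : ℝ),
      ∑ k, (((Pi.single i t : Fin (2 ^ (N - 1)) → ℝ) k : ℝ) : ℂ) • T k = (t : ℂ) • T i := by
    intro T i t
    rw [Finset.sum_eq_single i]
    · rw [Pi.single_eq_same]
    · intro k _ hk
      rw [Pi.single_eq_of_ne hk, Complex.ofReal_zero, zero_smul]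
    · exact fun h => absurd (Finset.mem_univ i) h
  have hSpair : ∀ (s : Fin (2 ^ (N - 1)) → ℝ) (ζ : Fin (2 ^ (N - 1)) → ℂ), (∀ k, 0 < s k) →
      (∀ k, ‖ζ k‖ ≤ 1) → ∀ i j (t : ℝ), i ≠ j → 0 ≤ t →
      Decomposes (∑ k, (((Pi.single i t + Pi.single j t : Fin (2 ^ (N - 1)) → ℝ) k : ℝ) : ℂ) •
        unitBlock (low hN k) (s k) (ζ k)) 0 := by
    intro s ζ hs hζ i j t hij ht
    simp only [Pi.add_apply, Complex.ofReal_add, add_smul, Finset.sum_add_distrib]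
    rw [hsingle (fun k => unitBlock (low hN k) (s k) (ζ k)),
      hsingle (fun k => unitBlock (low hN k) (s k) (ζ k)), ← smul_add]
    have h := (decomposes_unitBlock_add (fun h => hij (low_injective hN h))
      (low_ne_rev_low hN i j) (hs i) (hs j) (hζ i) (hζ j)).smul ht
    rwa [mul_zero] at h
  have hstar : ∀ (s : Fin (2 ^ (N - 1)) → ℝ) (ζ : Fin (2 ^ (N - 1)) → ℂ), (∀ k, 0 < s k) →
      (∀ k, ‖ζ k‖ ≤ 1) → ∀ (c : Fin (2 ^ (N - 1)) → ℝ), (∀ k, 0 ≤ c k) → ∀ i,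
      c i = ∑ j ∈ Finset.univ.erase i, c j →
      Decomposes (∑ k, (c k : ℂ) • unitBlock (low hN k) (s k) (ζ k)) 0 := by
    intro s ζ hs hζ c hc i hi
    refine star_induction
      (fun c => Decomposes (∑ k, (c k : ℂ) • unitBlock (low hN k) (s k) (ζ k)) 0)
      (hS0 _) (fun c d h h' => ?_) (hSpair s ζ hs hζ) c hc i hi
    have := hSadd _ c d 0 0 h h'
    rwa [add_zero] at this
  have hupd : ∀ i (x : ℝ), ∑ k ∈ Finset.univ.erase i,
      Function.update (fun k => √(a k * b k)) i x k = ∑ k ∈ Finset.univ.erase i, √(a k * b k) := by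
    intro i x
    exact Finset.sum_congr rfl fun k hk => Function.update_of_ne (Finset.ne_of_mem_erase hk) _ _
  have hw : ∀ i, 0 ≤ ∑ k ∈ Finset.univ.erase i, √(a k * b k) :=
    fun i => Finset.sum_nonneg fun k _ => hm k
  by_cases hA : ∃ i, ∑ k ∈ Finset.univ.erase i, √(a k * b k) ≤ ‖z i‖
  · obtain ⟨i, hi⟩ := hA
    refine Or.inl ⟨i, reduce (Function.update (fun k => √(a k * b k)) i ‖z i‖) _ ?_ ?_ ?_⟩
    · intro k
      by_cases hk : k = i
      · subst hk; rw [Function.update_self]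
      · rw [Function.update_of_ne hk]; exact hz k
    · intro k
      by_cases hk : k = i
      · subst hk; rw [Function.update_self]; exact hz k
      · rw [Function.update_of_ne hk]
    · intro s ζ hs hζ
      -- The weight $|z_i|$ is split into the sum of the other weights, which balances them at no
      -- cost, and the excess, which costs 2 per unit.
      have h1 := hstar s ζ hs hζ (Function.update (fun k => √(a k * b k)) i
        (∑ k ∈ Finset.univ.erase i, √(a k * b k))) (fun k => by
          by_cases hk : k = i
          · subst hk; rw [Function.update_self]; exact hw k
          · rw [Function.update_of_ne hk]; exact hm k) i
        (by rw [hupd, Function.update_self])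
      have h2 := (decomposes_unitBlock hN (low hN i) (hs i) (hζ i)).smul (sub_nonneg.2 hi)
      rw [← hsingle (fun k => unitBlock (low hN k) (s k) (ζ k))] at h2
      have h3 := hSadd _ _ _ _ _ h1 h2
      have e : Function.update (fun k => √(a k * b k)) i
          (∑ k ∈ Finset.univ.erase i, √(a k * b k)) + Pi.single i
          (‖z i‖ - ∑ k ∈ Finset.univ.erase i, √(a k * b k)) =
          Function.update (fun k => √(a k * b k)) i ‖z i‖ := by
        funext k
        by_cases hk : k = i
        · subst hk; simp
        · simp [hk]
      rw [e, zero_add, mul_comm] at h3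
      exact h3
  · push Not at hA
    right
    by_cases hB : ∀ i, √(a i * b i) ≤ ∑ k ∈ Finset.univ.erase i, √(a k * b k)
    · refine reduce (fun k => √(a k * b k)) 0 hz (fun k => le_rfl) fun s ζ hs hζ => ?_
      refine polygon_induction
        (fun c => Decomposes (∑ k, (c k : ℂ) • unitBlock (low hN k) (s k) (ζ k)) 0)
        (hS0 _) (fun c d h h' => ?_) (hSpair s ζ hs hζ) _ hm hB
      have := hSadd _ c d 0 0 h h'
      rwa [add_zero] at this
    · push Not at hB
      obtain ⟨i, hi⟩ := hB
      -- If the full weight of block $i$ is too large, it is lowered to the sum of the others. This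
      -- still dominates $|z_i|$, because no coherence reaches that sum in the present case.
      refine reduce (Function.update (fun k => √(a k * b k)) i
        (∑ k ∈ Finset.univ.erase i, √(a k * b k))) 0 ?_ ?_ fun s ζ hs hζ => ?_
      · intro k
        by_cases hk : k = i
        · subst hk; rw [Function.update_self]; exact (hA k).le
        · rw [Function.update_of_ne hk]; exact hz k
      · intro k
        by_cases hk : k = i
        · subst hk; rw [Function.update_self]; exact hi.le
        · rw [Function.update_of_ne hk]
      · refine hstar s ζ hs hζ _ (fun k => ?_) i (by rw [hupd, Function.update_self])
        by_cases hk : k = i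
        · subst hk; rw [Function.update_self]; exact hw k
        · rw [Function.update_of_ne hk]; exact hm k

/-! ### The spectral inequality -/

/-- Among all permutations with a fixed point `p`, the sum `∑_{j ≠ p} z_j z_{π j}` of a decreasing
sequence is smallest for `p = 0` and `π j = -j`. -/
theorem sum_mul_neg_le_sum_mul_perm {M : ℕ} [NeZero M] (z : Fin M → ℝ) (hz : Antitone z)
    (h0 : ∀ j, 0 ≤ z j) (π : Equiv.Perm (Fin M)) (p : Fin M) (hp : π p = p) :
    ∑ j, z j * z (-j) - z 0 * z 0 ≤ ∑ j, z j * z (π j) - z p * z p := by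
  -- Conjugating by this transposition moves the fixed point to 0. Away from 0, $z\circ s$ dominates
  -- $z$ because $z_0$ is the largest value, so replacing one by the other only lowers the sum.
  let s : Equiv.Perm (Fin M) := Equiv.swap 0 p
  let π' : Equiv.Perm (Fin M) := s.trans (π.trans s)
  have hs0 : s 0 = p := Equiv.swap_apply_left 0 p
  have hsp : s p = 0 := Equiv.swap_apply_right 0 p
  have hss : ∀ j, s (s j) = j := Equiv.swap_apply_self 0 p
  have hπ0 : π' 0 = 0 := by
    change s (π (s 0)) = 0
    rw [hs0, hp, hsp]
  have hle : ∀ j, j ≠ 0 → z j ≤ z (s j) := by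
    intro j hj
    by_cases hjp : j = p
    · rw [hjp, hsp]
      exact hz (Fin.zero_le _)
    · exact (congrArg z (Equiv.swap_apply_of_ne_of_ne hj hjp)).ge
  have e1 : ∑ j, z j * z (π j) - z p * z p =
      ∑ j ∈ Finset.univ.erase 0, z (s j) * z (s (π' j)) := by
    rw [Finset.sum_erase_eq_sub (Finset.mem_univ _), hπ0, hs0, ← Equiv.sum_comp s]
    congr 1
    refine Finset.sum_congr rfl fun j _ => ?_
    change _ = z (s j) * z (s (s (π (s j))))
    rw [hss]
  have e2 : ∑ j ∈ Finset.univ.erase 0, z j * z (π' j) ≤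
      ∑ j ∈ Finset.univ.erase 0, z (s j) * z (s (π' j)) := by
    refine Finset.sum_le_sum fun j hj => ?_
    have hj0 := Finset.ne_of_mem_erase hj
    have hπj : π' j ≠ 0 := fun h => hj0 (π'.injective (h.trans hπ0.symm))
    exact mul_le_mul (hle j hj0) (hle _ hπj) (h0 _) (h0 _)
  have hneg : ∀ j : Fin M, j ≠ 0 → ((-j : Fin M) : ℕ) = M - j := fun j => val_neg_of_ne_zero
  have hanti : AntivaryOn z (fun j => z (-j)) (Finset.univ.erase (0 : Fin M) : Finset (Fin M)) := by
    intro i hi j hj hij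
    have hi0 := Finset.ne_of_mem_erase (Finset.mem_coe.1 hi)
    have hj0 := Finset.ne_of_mem_erase (Finset.mem_coe.1 hj)
    have hlt : -j < -i := by
      by_contra h
      exact absurd (hz (not_lt.1 h)) (not_le.2 hij)
    rw [Fin.lt_def, hneg i hi0, hneg j hj0] at hlt
    exact hz (Fin.le_def.2 (by omega))
  -- Rearrangement inequality: negation reverses the order of the nonzero indices, so the two
  -- sequences are oppositely ordered there and their termwise pairing is minimal.
  have e3 := hanti.sum_mul_le_sum_mul_comp_perm (σ := π'.trans (Equiv.neg (Fin M))) (by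
    intro x hx
    rw [Finset.mem_coe, Finset.mem_erase]
    refine ⟨?_, Finset.mem_univ x⟩
    rintro rfl
    apply hx
    change -(π' 0) = 0
    rw [hπ0, neg_zero])
  have e4 : ∑ j ∈ Finset.univ.erase 0, z j * z (-((π'.trans (Equiv.neg (Fin M))) j)) =
      ∑ j ∈ Finset.univ.erase 0, z j * z (π' j) :=
    Finset.sum_congr rfl fun j _ => by
      change z j * z (- -(π' j)) = _
      rw [neg_neg]
  rw [e4] at e3
  have e5 : ∑ j ∈ Finset.univ.erase (0 : Fin M), z j * z (-j) =
      ∑ j, z j * z (-j) - z 0 * z 0 := by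
    rw [Finset.sum_erase_eq_sub (Finset.mem_univ _), neg_zero]
  rw [e1, ← e5]
  exact e3.trans e2

theorem sum_erase_zero_eq_sum_Icc_two {n : ℕ} [NeZero n] (f : ℕ → ℝ) :
    ∑ k ∈ Finset.univ.erase (0 : Fin n), f ((k : ℕ) + 1) = ∑ l ∈ Finset.Icc 2 n, f l := by
  have hn : 0 < n := Nat.pos_of_ne_zero (NeZero.ne n)
  have h : Finset.Icc 2 n = (Finset.Icc 1 n).erase 1 := by
    ext k
    simp only [Finset.mem_Icc, Finset.mem_erase]
    omega
  rw [h, Finset.sum_erase_eq_sub (Finset.mem_Icc.2 ⟨le_rfl, hn⟩), sum_Icc_one_eq_sum_fin,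
    Finset.sum_erase_eq_sub (Finset.mem_univ _)]
  rfl

theorem colEquiv_inr_eq_neg {N : ℕ} (hN : 2 ≤ N) {k : Fin (2 ^ (N - 1))} (hk : k ≠ 0) :
    colEquiv hN (Sum.inr k) = -colEquiv hN (Sum.inl k) := by
  have hk' : colEquiv hN (Sum.inl k) ≠ 0 := by
    intro h
    apply hk
    apply Fin.ext
    have := congrArg Fin.val h
    rwa [colEquiv_inl_val] at this
  apply Fin.ext
  have h := two_mul_half hN
  rw [val_neg_of_ne_zero hk', colEquiv_inr_val, colEquiv_inl_val, val_neg_of_ne_zero hk]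
  omega

theorem neg_colEquiv_inr_zero {N : ℕ} (hN : 2 ≤ N) :
    -colEquiv hN (Sum.inr 0) = colEquiv hN (Sum.inr 0) := by
  have hv : (colEquiv hN (Sum.inr 0) : ℕ) = 2 ^ (N - 1) := by
    rw [colEquiv_inr_val, neg_zero]; rfl
  have hne : colEquiv hN (Sum.inr 0) ≠ 0 := by
    intro h
    have h1 := congrArg Fin.val h
    rw [hv] at h1
    have : 0 < 2 ^ (N - 1) := by positivity
    have h2 : ((0 : Fin (2 ^ N)) : ℕ) = 0 := rfl
    omega
  apply Fin.ext
  have h := two_mul_half hN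
  rw [val_neg_of_ne_zero hne, hv]
  omega

/-- The optimal arrangement of the square roots of the eigenvalues. -/
theorem sum_mul_neg_eq {N : ℕ} (hN : 2 ≤ N) (lam : ℕ → ℝ)
    (hnonneg : ∀ k ∈ Set.Icc 1 (2 ^ N), 0 ≤ lam k) :
    ∑ j : Fin (2 ^ N), √(lam ((j : ℕ) + 1)) * √(lam (((-j : Fin (2 ^ N)) : ℕ) + 1)) -
      √(lam 1) * √(lam 1) = lam (2 ^ (N - 1) + 1) +
      2 * ∑ l ∈ Finset.Icc 2 (2 ^ (N - 1)), √(lam l * lam (2 * 2 ^ (N - 1) + 2 - l)) := by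
  have h2 := two_mul_half hN
  have hpos : 0 < 2 ^ (N - 1) := by positivity
  -- Negation on `Fin (2 ^ N)` fixes exactly $0$ and $n=2^{N-1}$. The first contributes the
  -- subtracted $\lambda_1$, the second $\lambda_{n+1}$, and every other pair $\{j,2n-j\}$
  -- contributes its product twice.
  rw [← (colEquiv hN).sum_comp, Fintype.sum_sum_type,
    ← Finset.add_sum_erase Finset.univ _ (Finset.mem_univ (0 : Fin (2 ^ (N - 1)))),
    ← Finset.add_sum_erase Finset.univ (fun k => √(lam ((colEquiv hN (Sum.inr k) : ℕ) + 1)) *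
      √(lam (((-colEquiv hN (Sum.inr k) : Fin (2 ^ N)) : ℕ) + 1)))
      (Finset.mem_univ (0 : Fin (2 ^ (N - 1)))),
    ← sum_erase_zero_eq_sum_Icc_two]
  have hz : colEquiv hN (Sum.inl 0) = 0 := rfl
  have hv : (colEquiv hN (Sum.inr 0) : ℕ) = 2 ^ (N - 1) := by
    rw [colEquiv_inr_val, neg_zero]; rfl
  have hterm : ∀ k ∈ Finset.univ.erase (0 : Fin (2 ^ (N - 1))),
      √(lam ((colEquiv hN (Sum.inl k) : ℕ) + 1)) *
        √(lam (((-colEquiv hN (Sum.inl k) : Fin (2 ^ N)) : ℕ) + 1)) =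
      √(lam ((k : ℕ) + 1) * lam (2 * 2 ^ (N - 1) + 2 - ((k : ℕ) + 1))) := by
    intro k hk
    have hk0 := Finset.ne_of_mem_erase hk
    rw [← colEquiv_inr_eq_neg hN hk0, colEquiv_inl_val, colEquiv_inr_val, val_neg_of_ne_zero hk0,
      ← Real.sqrt_mul (hnonneg _ ⟨by omega, by omega⟩)]
    congr 3
    omega
  have hterm' : ∀ k ∈ Finset.univ.erase (0 : Fin (2 ^ (N - 1))),
      √(lam ((colEquiv hN (Sum.inr k) : ℕ) + 1)) *
        √(lam (((-colEquiv hN (Sum.inr k) : Fin (2 ^ N)) : ℕ) + 1)) =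
      √(lam ((k : ℕ) + 1) * lam (2 * 2 ^ (N - 1) + 2 - ((k : ℕ) + 1))) := by
    intro k hk
    rw [← hterm k hk, colEquiv_inr_eq_neg hN (Finset.ne_of_mem_erase hk), neg_neg, mul_comm]
  rw [Finset.sum_congr rfl hterm, Finset.sum_congr rfl hterm', hz, neg_zero, neg_colEquiv_inr_zero,
    hv, Real.mul_self_sqrt (hnonneg (2 ^ (N - 1) + 1) ⟨by omega, by omega⟩)]
  have h00 : ((0 : Fin (2 ^ N)) : ℕ) + 1 = 1 := rfl
  rw [h00]
  ring

/-- The spectral bound: if the eigenvalues `μ k`, `ν k` of the blocks are the `lam j`, then no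
block can exceed the optimal value. -/
theorem pair_excess_le {N : ℕ} (hN : 2 ≤ N) (lam : ℕ → ℝ)
    (hanti : AntitoneOn lam (Set.Icc 1 (2 ^ N)))
    (hnonneg : ∀ k ∈ Set.Icc 1 (2 ^ N), 0 ≤ lam k) (μ ν : Fin (2 ^ (N - 1)) → ℝ)
    (σ : Fin (2 ^ (N - 1)) ⊕ Fin (2 ^ (N - 1)) ≃ Fin (2 ^ N))
    (hσ : ∀ x, lam ((σ x : ℕ) + 1) = Sum.elim μ ν x) (i : Fin (2 ^ (N - 1))) :
    μ i - ν i - 2 * ∑ k ∈ Finset.univ.erase i, √(μ k) * √(ν k) ≤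
      lam 1 - lam (2 ^ (N - 1) + 1) -
        2 * ∑ l ∈ Finset.Icc 2 (2 ^ (N - 1)), √(lam l * lam (2 * 2 ^ (N - 1) + 2 - l)) := by
  have hpos : 0 < 2 ^ N := by positivity
  have hmem : ∀ j : Fin (2 ^ N), (j : ℕ) + 1 ∈ Set.Icc 1 (2 ^ N) := fun j => ⟨by omega, by omega⟩
  have hμ : ∀ k, 0 ≤ μ k := fun k => by
    have := hnonneg _ (hmem (σ (Sum.inl k)))
    rwa [hσ] at this
  have hν : ∀ k, 0 ≤ ν k := fun k => by
    have := hnonneg _ (hmem (σ (Sum.inr k)))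
    rwa [hσ] at this
  -- Each eigenvalue is exchanged with its partner in the same block, except in block $i$, whose two
  -- eigenvalues stay fixed. The excess of block $i$ then becomes $\mu_i$ minus the permutation sum
  -- without its term $\mu_i$; the first is at most $\lambda_1$ and the second is minimized by
  -- rearrangement.
  let τ : Equiv.Perm (Fin (2 ^ (N - 1)) ⊕ Fin (2 ^ (N - 1))) :=
    (Equiv.swap (Sum.inl i) (Sum.inr i)).trans (Equiv.sumComm _ _)
  let π : Equiv.Perm (Fin (2 ^ N)) := σ.symm.trans (τ.trans σ)
  have hπ : ∀ x, π (σ x) = σ (τ x) := fun x => by simp [π]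
  have hτl : τ (Sum.inl i) = Sum.inl i := by simp [τ]
  have hτr : τ (Sum.inr i) = Sum.inr i := by simp [τ]
  have hτl' : ∀ k, k ≠ i → τ (Sum.inl k) = Sum.inr k := fun k hk => by
    simp [τ, Equiv.swap_apply_of_ne_of_ne, hk]
  have hτr' : ∀ k, k ≠ i → τ (Sum.inr k) = Sum.inl k := fun k hk => by
    simp [τ, Equiv.swap_apply_of_ne_of_ne, hk]
  have hmain := sum_mul_neg_le_sum_mul_perm (fun j : Fin (2 ^ N) => √(lam ((j : ℕ) + 1)))
    (fun j k hjk => Real.sqrt_le_sqrt (hanti (hmem j) (hmem k) (by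
      have := Fin.le_def.1 hjk
      omega)))
    (fun j => Real.sqrt_nonneg _) π (σ (Sum.inl i)) (by rw [hπ, hτl])
  have h00 : ((0 : Fin (2 ^ N)) : ℕ) + 1 = 1 := rfl
  have hsum : ∑ j : Fin (2 ^ N), √(lam ((j : ℕ) + 1)) * √(lam ((π j : ℕ) + 1)) =
      μ i + ν i + 2 * ∑ k ∈ Finset.univ.erase i, √(μ k) * √(ν k) := by
    rw [← σ.sum_comp, Fintype.sum_sum_type,
      ← Finset.add_sum_erase Finset.univ _ (Finset.mem_univ i),
      ← Finset.add_sum_erase Finset.univ (fun k => √(lam ((σ (Sum.inr k) : ℕ) + 1)) *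
        √(lam ((π (σ (Sum.inr k)) : ℕ) + 1))) (Finset.mem_univ i)]
    simp only [hπ, hτl, hτr, hσ, Sum.elim_inl, Sum.elim_inr, Real.mul_self_sqrt (hμ i),
      Real.mul_self_sqrt (hν i)]
    have e1 : ∀ k ∈ Finset.univ.erase i, √(μ k) * √(Sum.elim μ ν (τ (Sum.inl k))) =
        √(μ k) * √(ν k) := fun k hk => by rw [hτl' k (Finset.ne_of_mem_erase hk)]; rfl
    have e2 : ∀ k ∈ Finset.univ.erase i, √(ν k) * √(Sum.elim μ ν (τ (Sum.inr k))) =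
        √(μ k) * √(ν k) := fun k hk => by
      rw [hτr' k (Finset.ne_of_mem_erase hk), mul_comm]; rfl
    rw [Finset.sum_congr rfl e1, Finset.sum_congr rfl e2]
    ring
  beta_reduce at hmain
  rw [h00, sum_mul_neg_eq hN lam hnonneg, hsum, hσ, Sum.elim_inl,
    Real.mul_self_sqrt (hμ i)] at hmain
  have hle : μ i ≤ lam 1 := by
    have := hanti ⟨le_rfl, hpos⟩ (hmem (σ (Sum.inl i))) (by omega)
    rwa [hσ] at this
  linarith

/-! ### The GM-concurrence of X-states -/

/-- The decomposition that gives the upper bound is itself an ensemble; it is recorded because the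
lower bound needs one. -/
theorem CGM_le_optCGM {N : ℕ} (hN : 2 ≤ N) (lam : ℕ → ℝ)
    (hanti : AntitoneOn lam (Set.Icc 1 (2 ^ N)))
    (hnonneg : ∀ k ∈ Set.Icc 1 (2 ^ N), 0 ≤ lam k) {ρ : QMat N} (hρ : IsXDensity hN ρ)
    (hs : HasSpectrum ρ lam) :
    (∃ (m : ℕ) (p : Fin m → ℝ) (ψ : Fin m → Fin (2 ^ N) → ℂ), IsEnsemble ρ p ψ) ∧
      CGM ρ ≤ optCGM N lam := by
  obtain ⟨a, b, r, φ, hk, htr, rfl⟩ := hρ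
  have hmem : ∀ k : Fin (2 ^ (N - 1)), (k : ℕ) + 1 ∈ Finset.Icc 1 (2 ^ (N - 1)) :=
    fun k => Finset.mem_Icc.2 ⟨by omega, by omega⟩
  have htrace : (xMatrix hN a b r φ).trace = 1 := by
    rw [trace_xMatrix, htr, Complex.ofReal_one]
  rw [hasSpectrum_iff, roots_charpoly_xMatrix hN a b r φ fun k hk' => (hk k hk').2.2.1] at hs
  obtain ⟨σ, hσ⟩ := exists_equiv_of_map_univ_eq _ _ hs
  have hdec := decomposes_xMatrix hN (fun k => a ((k : ℕ) + 1)) (fun k => b ((k : ℕ) + 1))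
    (fun k => antiEntry r φ ((k : ℕ) + 1)) (fun k => (hk _ (hmem k)).1)
    (fun k => (hk _ (hmem k)).2.1) (fun k => by
      rw [norm_antiEntry _ _ _ (hk _ (hmem k)).2.2.1]
      exact (hk _ (hmem k)).2.2.2.1)
  rw [← xMatrix_eq_sum] at hdec
  rcases hdec with ⟨i, hi⟩ | h0
  · obtain ⟨m, p, ψ, he, -⟩ := hi.exists_isEnsemble htrace
    refine ⟨⟨m, p, ψ, he⟩, (hi.CGM_le htrace).trans (le_trans ?_ (le_max_right _ _))⟩
    have hex := pair_excess_le hN lam hanti hnonneg _ _ σ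
      (fun x => Complex.ofReal_injective (hσ x)) i
    refine le_trans ?_ hex
    rw [norm_antiEntry _ _ _ (hk _ (hmem i)).2.2.1]
    have h1 := two_mul_le_blockEig_sub (a ((i : ℕ) + 1)) (b ((i : ℕ) + 1)) (r ((i : ℕ) + 1))
    -- The determinant of a block gives $\mu_k\nu_k=a_kb_k-r_k^2\le a_kb_k$.
    have h2 : ∑ k ∈ Finset.univ.erase i,
        √(blockEig 1 (a ((k : ℕ) + 1)) (b ((k : ℕ) + 1)) (r ((k : ℕ) + 1))) *
        √(blockEig (-1) (a ((k : ℕ) + 1)) (b ((k : ℕ) + 1)) (r ((k : ℕ) + 1))) ≤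
        ∑ k ∈ Finset.univ.erase i, √(a ((k : ℕ) + 1) * b ((k : ℕ) + 1)) := by
      refine Finset.sum_le_sum fun k _ => ?_
      have hpos : 0 ≤ blockEig 1 (a ((k : ℕ) + 1)) (b ((k : ℕ) + 1)) (r ((k : ℕ) + 1)) := by
        have ha := (hk _ (hmem k)).1
        have hb := (hk _ (hmem k)).2.1
        unfold blockEig
        positivity
      rw [← Real.sqrt_mul hpos, blockEig_mul]
      exact Real.sqrt_le_sqrt (by nlinarith [sq_nonneg (r ((k : ℕ) + 1))])
    linarith
  · obtain ⟨m, p, ψ, he, -⟩ := h0.exists_isEnsemble htrace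
    exact ⟨⟨m, p, ψ, he⟩, (h0.CGM_le htrace).trans (le_max_left _ _)⟩

/-- The only coherence of $\rho'_\Lambda$ sits on the pair of the all-zero and all-one strings, the
pair singled out by `le_CGM`, and the other pairs have diagonal entries $\lambda_\ell$ and
$\lambda_{2n+2-\ell}$. The lower bound therefore equals the optimal expression. -/
theorem CGM_rhoOpt {N : ℕ} (hN : 2 ≤ N) (lam : ℕ → ℝ)
    (hanti : AntitoneOn lam (Set.Icc 1 (2 ^ N)))
    (hnonneg : ∀ k ∈ Set.Icc 1 (2 ^ N), 0 ≤ lam k)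
    (hsum : ∑ k ∈ Finset.Icc 1 (2 ^ N), lam k = 1) :
    CGM (rhoOpt hN lam) = optCGM N lam := by
  obtain ⟨hens, hle⟩ := CGM_le_optCGM hN lam hanti hnonneg
    (isXDensity_rhoOpt hN lam hanti hnonneg hsum) (hasSpectrum_rhoOpt hN lam)
  refine le_antisymm hle (max_le (CGM_nonneg _) (le_trans (le_of_eq ?_) (le_CGM hN _ hens)))
  have h2 := two_mul_half hN
  have hpos : 0 < 2 ^ (N - 1) := by positivity
  have hle1 : lam (2 ^ (N - 1) + 1) ≤ lam 1 :=
    hanti ⟨le_rfl, by omega⟩ ⟨by omega, by omega⟩ (by omega)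
  have hll : ∀ (a b r φ : ℕ → ℝ) k, xMatrix hN a b r φ (low hN k) (low hN k) =
      (a ((k : ℕ) + 1) : ℂ) := by
    intro a b r φ k
    rw [xMatrix_eq_reindex, Matrix.reindex_apply, Matrix.submatrix_apply, low,
      Equiv.symm_apply_apply]
    simp
  have hrr : ∀ (a b r φ : ℕ → ℝ) k, xMatrix hN a b r φ (low hN k).rev (low hN k).rev =
      (b ((k : ℕ) + 1) : ℂ) := by
    intro a b r φ k
    rw [xMatrix_eq_reindex, Matrix.reindex_apply, Matrix.submatrix_apply, ← pairEquiv_inr,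
      Equiv.symm_apply_apply]
    simp
  have hlr : ∀ (a b r φ : ℕ → ℝ) k, xMatrix hN a b r φ (low hN k) (low hN k).rev =
      antiEntry r φ ((k : ℕ) + 1) := by
    intro a b r φ k
    rw [xMatrix_eq_reindex, Matrix.reindex_apply, Matrix.submatrix_apply, ← pairEquiv_inr, low,
      Equiv.symm_apply_apply, Equiv.symm_apply_apply]
    simp
  unfold rhoOpt
  simp only [hll, hrr, hlr, Complex.ofReal_re]
  have h00 : ((0 : Fin (2 ^ (N - 1))) : ℕ) + 1 = 1 := rfl
  rw [norm_antiEntry _ _ _ (by rw [h00, if_pos rfl]; linarith), h00, if_pos rfl]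
  have hterm : ∀ k ∈ Finset.univ.erase (0 : Fin (2 ^ (N - 1))),
      √((if (k : ℕ) + 1 = 1 then (lam 1 + lam (2 ^ (N - 1) + 1)) / 2 else lam ((k : ℕ) + 1)) *
        (if (k : ℕ) + 1 = 1 then (lam 1 + lam (2 ^ (N - 1) + 1)) / 2 else
          lam (2 * 2 ^ (N - 1) + 2 - ((k : ℕ) + 1)))) =
      √(lam ((k : ℕ) + 1) * lam (2 * 2 ^ (N - 1) + 2 - ((k : ℕ) + 1))) := by
    intro k hk
    have hk1 : ¬ ((k : ℕ) + 1 = 1) := fun h =>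
      Finset.ne_of_mem_erase hk (Fin.ext (Nat.succ_injective h))
    rw [if_neg hk1, if_neg hk1]
  rw [Finset.sum_congr rfl hterm, sum_erase_zero_eq_sum_Icc_two fun l =>
    √(lam l * lam (2 * 2 ^ (N - 1) + 2 - l))]
  ring

/-! ### The global unitary -/

theorem diag_mul_Lam_mul_conjTranspose {N : ℕ} (lam : ℕ → ℝ) {D : QMat N}
    (hD : D ∈ Matrix.unitaryGroup (Fin (2 ^ N)) ℂ) (hdiag : D.IsDiag) :
    D * Lam N lam * D.conjTranspose = Lam N lam := by
  have hDD : D * D.conjTranspose = 1 := Matrix.mem_unitaryGroup_iff.1 hD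
  have hcomm : D * Lam N lam = Lam N lam * D := by
    rw [← hdiag.diagonal_diag, Lam, Matrix.diagonal_mul_diagonal, Matrix.diagonal_mul_diagonal]
    exact congrArg _ (funext fun i => mul_comm _ _)
  rw [hcomm, Matrix.mul_assoc, hDD, Matrix.mul_one]

theorem globalU_mem_unitaryGroup {N : ℕ} (hN : 2 ≤ N) {U : Fin N → Matrix (Fin 2) (Fin 2) ℂ}
    {D Φ : QMat N} (hU : ∀ k, U k ∈ Matrix.unitaryGroup (Fin 2) ℂ)
    (hD : D ∈ Matrix.unitaryGroup (Fin (2 ^ N)) ℂ)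
    (hΦ : Φ ∈ Matrix.unitaryGroup (Fin (2 ^ N)) ℂ) :
    globalU hN U D Φ ∈ Matrix.unitaryGroup (Fin (2 ^ N)) ℂ :=
  mul_mem (mul_mem (mul_mem (localOp_mem_unitaryGroup hU) (V_mem_unitaryGroup hN)) hD)
    (Unitary.star_mem hΦ)

theorem globalU_conj {N : ℕ} (hN : 2 ≤ N) (lam : ℕ → ℝ) (U : Fin N → Matrix (Fin 2) (Fin 2) ℂ)
    {D Φ ρ : QMat N} (hD : D ∈ Matrix.unitaryGroup (Fin (2 ^ N)) ℂ) (hdiag : D.IsDiag)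
    (hΦ : Diagonalizes Φ ρ lam) :
    globalU hN U D Φ * ρ * (globalU hN U D Φ).conjTranspose =
      localOp U * rhoOpt hN lam * (localOp U).conjTranspose := by
  obtain ⟨hΦ, rfl⟩ := hΦ
  have hΦΦ : Φ.conjTranspose * Φ = 1 := Matrix.mem_unitaryGroup_iff'.1 hΦ
  have h1 : ∀ X : QMat N, Φ.conjTranspose * (Φ * X) = X := fun X => by
    rw [← Matrix.mul_assoc, hΦΦ, Matrix.one_mul]
  rw [← V_mul_Lam_mul_conjTranspose, globalU]
  conv_rhs => rw [← diag_mul_Lam_mul_conjTranspose lam hD hdiag]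
  simp only [Matrix.conjTranspose_mul, Matrix.conjTranspose_conjTranspose, Matrix.mul_assoc, h1]

end XMEMS

end

/-! ### Assembly of the theorem -/

theorem theorem1 (N : ℕ) (hN : 2 ≤ N) (lam : ℕ → ℝ)
    (hanti : AntitoneOn lam (Set.Icc 1 (2 ^ N)))
    (hnonneg : ∀ k ∈ Set.Icc 1 (2 ^ N), 0 ≤ lam k)
    (hsum : ∑ k ∈ Finset.Icc 1 (2 ^ N), lam k = 1) :
    -- the maximal GM-concurrence over the X-states of the given spectrum
    IsGreatest {c : ℝ | ∃ ρ : XMEMS.QMat N,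
        XMEMS.IsXState hN ρ ∧ XMEMS.HasSpectrum ρ lam ∧ XMEMS.CGM ρ = c}
      (XMEMS.optCGM N lam) ∧
    -- it is attained by the explicit X-density matrix
    (XMEMS.IsXDensity hN (XMEMS.rhoOpt hN lam) ∧
      XMEMS.HasSpectrum (XMEMS.rhoOpt hN lam) lam ∧
      XMEMS.CGM (XMEMS.rhoOpt hN lam) = XMEMS.optCGM N lam) ∧
    -- every density matrix of that spectrum is sent to an optimal X-state by the global unitary
    (∀ ρ : XMEMS.QMat N, XMEMS.IsDensity ρ → XMEMS.HasSpectrum ρ lam →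
      (∃ Φ : XMEMS.QMat N, XMEMS.Diagonalizes Φ ρ lam) ∧
      ∀ (Φ : XMEMS.QMat N) (U : Fin N → Matrix (Fin 2) (Fin 2) ℂ) (D : XMEMS.QMat N),
        XMEMS.Diagonalizes Φ ρ lam →
        (∀ k, U k ∈ Matrix.unitaryGroup (Fin 2) ℂ) →
        D ∈ Matrix.unitaryGroup (Fin (2 ^ N)) ℂ → D.IsDiag →
        XMEMS.globalU hN U D Φ ∈ Matrix.unitaryGroup (Fin (2 ^ N)) ℂ ∧
        XMEMS.globalU hN U D Φ * ρ * (XMEMS.globalU hN U D Φ).conjTranspose =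
          XMEMS.localOp U * XMEMS.rhoOpt hN lam * (XMEMS.localOp U).conjTranspose ∧
        XMEMS.IsXState hN
          (XMEMS.globalU hN U D Φ * ρ * (XMEMS.globalU hN U D Φ).conjTranspose) ∧
        XMEMS.HasSpectrum
          (XMEMS.globalU hN U D Φ * ρ * (XMEMS.globalU hN U D Φ).conjTranspose) lam ∧
        XMEMS.CGM (XMEMS.globalU hN U D Φ * ρ * (XMEMS.globalU hN U D Φ).conjTranspose) =
          XMEMS.optCGM N lam) := by
  have hX := XMEMS.isXDensity_rhoOpt hN lam hanti hnonneg hsum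
  have hS := XMEMS.hasSpectrum_rhoOpt hN lam
  have hC := XMEMS.CGM_rhoOpt hN lam hanti hnonneg hsum
  have hloc : ∀ U : Fin N → Matrix (Fin 2) (Fin 2) ℂ,
      (∀ k, U k ∈ Matrix.unitaryGroup (Fin 2) ℂ) →
      XMEMS.IsXState hN
        (XMEMS.localOp U * XMEMS.rhoOpt hN lam * (XMEMS.localOp U).conjTranspose) ∧
      XMEMS.HasSpectrum
        (XMEMS.localOp U * XMEMS.rhoOpt hN lam * (XMEMS.localOp U).conjTranspose) lam ∧
      XMEMS.CGM (XMEMS.localOp U * XMEMS.rhoOpt hN lam * (XMEMS.localOp U).conjTranspose) =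
        XMEMS.optCGM N lam := fun U hU =>
    ⟨⟨U, _, hU, hX, rfl⟩,
      (XMEMS.hasSpectrum_conj_unitary (XMEMS.localOp_mem_unitaryGroup hU) _ _).2 hS,
      (XMEMS.CGM_localOp hU _).trans hC⟩
  refine ⟨⟨⟨_, hloc (fun _ => 1) fun _ => one_mem _⟩, ?_⟩, ⟨hX, hS, hC⟩, fun ρ hρ hρs =>
    ⟨XMEMS.exists_diagonalizes ρ lam hρ hρs, fun Φ U D hΦ hU hD hdiag => ?_⟩⟩
  · rintro _ ⟨ρ, ⟨U, σ, hU, hσ, rfl⟩, hs, rfl⟩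
    rw [XMEMS.CGM_localOp hU]
    exact (XMEMS.CGM_le_optCGM hN lam hanti hnonneg hσ
      ((XMEMS.hasSpectrum_conj_unitary (XMEMS.localOp_mem_unitaryGroup hU) _ _).1 hs)).2
  · have he := XMEMS.globalU_conj hN lam U hD hdiag hΦ
    refine ⟨XMEMS.globalU_mem_unitaryGroup hN hU hD hΦ.1, he, ?_⟩
    rw [he]
    exact hloc U hU
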